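/- **Setting.** A *discrete desingularization* of a set $\mathcal Q$ is an atomless standard Borel probability space $(X,\mu)$ with a map $p:X\to\mathcal Q$ with countable fibres such that the equivalence relation $R_p=\{(x,y): p(x)=p(y)\}$ is Borel and $\mu$ is quasi-invariant (the $R_p$-saturation of a $\mu$-null Borel set is $\mu$-null). Two discrete desingularizations $p,p'$ of $\mathcal Q$ are *equivalent* if $X\times_{\mathcal Q}X'$ is Borel in $X\times X'$ and, for every $N\subseteq\mathcal Q$, $\mu(p^{-1}N)=0\iff\mu'(p'^{-1}N)=0$. A (measured) *singular space* is a set $\mathcal Q$ with a discrete desingularization up to equivalence; the members of the equivalence class are called the discrete desingularizations of $\mathcal Q$. "Almost every" $(x,y)\in R$ refers to the measure $h(K)=\int_X\#\{y:(x,y)\in K\}\,d\mu(x)$. *Property T.* A measured relation $R$ on $(X,\mu)$ has property T if every unitary representation $\pi(x,y):H_y\to H_x$, $(x,y)\in R$, of $R$ on a measurable field $H$ of separable complex Hilbert spaces which almost has invariant fields has a measurable field $\xi$ with $\|\xi_x\|=1$ a.e. and $\pi(x,y)\xi_y=\xi_x$ for a.e. $(x,y)\in R$. Here $\pi$ *almost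 has invariant fields* if there are measurable fields $\xi^n$ with $\|\xi^n_x\|=1$ a.e., Borel sets $K_1\subseteq K_2\subseteq\dots\subseteq R$ exhausting $R$ up to a null set, and $\varepsilon_n\to0$, with $\|\pi(x,y)\xi^n_y-\xi^n_x\|\le\varepsilon_n$ for a.e. $(x,y)\in K_n$. A singular space has property T if the relations $R_p$ of all its discrete desingularizations have property T. *Complexes.* A *$\mathcal Q$-periodic simplicial complex of dimension 2* is given by its simplicial desingularization $\Sigma\to\mathcal Q$: a Borel simplicial complex of dimension at most 2 whose vertex set $X=\Sigma^{(0)}$ is a discrete desingularization of $\mathcal Q$, every simplex lying in a single fibre (leaf). It is *uniformly locally finite* if for some $N$ almost every vertex lies in at most $N$ simplices. The link of a vertex $x$ is the graph whose vertices are the edges of $\Sigma$ at $x$ and whose edges are the triangles of $\Sigma$ at $x$. For a finite graph $L$ with valency function $\tau$, let $D_Lf(y)=\tau(y)^{-1}\sum_{z\sim y}f(z)$ on functions $f:L^{(0)}\to\mathbb C$ (with $D_Lf(y)=0$ if $\tau(y)=0$), and let $\lambda_1(L)$ be the smallest nonzero eigenvalue of $\mathrm{Id}-D_L$. **Theorem.**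 Let $\mathcal Q$ be a singular space and let $\Sigma\to\mathcal Q$ be the simplicial desingularization of a uniformly locally finite $\mathcal Q$-periodic simplicial complex of dimension 2, almost all of whose leaves are connected (so that the 1-skeleton is a graphing of the relation $R$ on the vertex set $X$, and $\mathcal Q$ is of finite type). Let $\mu$ be the quasi-invariant probability measure on $X$, let $\delta$ be its Radon–Nikodym cocycle, $\int_X\sum_{y\sim x}F(x,y)\,d\mu(x)=\int_X\sum_{x\sim y}F(x,y)\,\delta(x,y)\,d\mu(y)$ for all Borel $F\ge0$, and let $\delta_\mu\ge1$ be a real number such that $\delta_\mu^{-1}\le\delta(y,z)\le\delta_\mu$ for almost every edge $(y,z)$ of $\Sigma$. Suppose that there is a real number $\lambda>\delta_\mu^3/2$ such that for almost every vertex $x$ the link $L_x$ is connected and $\lambda_1(L_x)\ge\lambda$. Then $\mathcal Q$ has property T. -/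

import Mathlib

open MeasureTheory Filter Topology
open scoped ENNReal NNReal

universe u

/-! ### Measured singular spaces and their discrete desingularizations -/

/-- A discrete desingularization `proj : X → Q` of a set `Q`: an atomless standard Borel
probability space `X` and a map with countable fibres to `Q`, such that the equivalence relation
`proj x = proj y` on `X` is Borel and `μ` is quasi-invariant (the saturation of a null Borel set
is null). -/
structure DiscreteDesingularization (Q : Type u) where
  X : Type u
  [measurableSpace : MeasurableSpace X]
  [standardBorel : StandardBorelSpace X]
  μ : Measure X
  [isProbability : IsProbabilityMeasure μ]
  [noAtoms : NullSingletonClass μ]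
  proj : X → Q
  countable_fiber : ∀ q : Q, (proj ⁻¹' {q}).Countable
  measurableSet_rel : MeasurableSet {z : X × X | proj z.1 = proj z.2}
  quasiInvariant : ∀ A : Set X, MeasurableSet A → μ A = 0 → μ (proj ⁻¹' (proj '' A)) = 0

attribute [instance] DiscreteDesingularization.measurableSpace
  DiscreteDesingularization.standardBorel DiscreteDesingularization.isProbability
  DiscreteDesingularization.noAtoms

namespace DiscreteDesingularization

variable {Q : Type u}

/-- Two discrete desingularizations of `Q` define the same measured structure on `Q`: their fibre
product over `Q` is Borel, and they have the same null sets in `Q`.  (The second condition applied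
to the complement of an image shows that each image is conull for the other.) -/
def Equivalent (D D' : DiscreteDesingularization Q) : Prop :=
  MeasurableSet {z : D.X × D'.X | D.proj z.1 = D'.proj z.2} ∧
    ∀ N : Set Q, D.μ (D.proj ⁻¹' N) = 0 ↔ D'.μ (D'.proj ⁻¹' N) = 0

/-- The equivalence relation on `X` whose classes are the fibres of `proj`. -/
def Rel (D : DiscreteDesingularization Q) (x y : D.X) : Prop := D.proj x = D.proj y

theorem rel_refl (D : DiscreteDesingularization Q) (x : D.X) : D.Rel x x := rfl

theorem Rel.trans' {D : DiscreteDesingularization Q} {x y z : D.X} (h : D.Rel x y)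
    (h' : D.Rel y z) : D.Rel x z := Eq.trans h h'

/-- A property holds for almost every pair of the relation, with respect to the horizontal
counting measure `K ↦ ∫ #{y | (x, y) ∈ K} dμ(x)`. -/
def AEPair (D : DiscreteDesingularization Q) (P : ∀ x y : D.X, D.Rel x y → Prop) : Prop :=
  ∀ᵐ x ∂D.μ, ∀ (y : D.X) (h : D.Rel x y), P x y h

/-- `δ` is the Radon-Nikodym cocycle of `μ`, i.e. the density of the horizontal counting measure of
the relation with respect to the vertical one (so that `δ x y` plays the role of
`dμ(x) / dμ(y)`). It is determined up to a null set of pairs; its values off the relation are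
irrelevant. -/
def IsRadonNikodymCocycle (D : DiscreteDesingularization Q) (δ : D.X → D.X → ℝ≥0) : Prop :=
  Measurable (Function.uncurry δ) ∧
    ∀ F : D.X → D.X → ℝ≥0∞, Measurable (Function.uncurry F) →
      ∫⁻ x, ∑' y : {y : D.X // D.Rel x y}, F x y ∂D.μ =
        ∫⁻ y, ∑' x : {x : D.X // D.Rel x y}, F x y * (δ x y : ℝ≥0∞) ∂D.μ

end DiscreteDesingularization

/-- A measured singular space: a set with the measured structure determined by a discrete
desingularization. -/
structure SingularSpace where
  carrier : Type u
  ref : DiscreteDesingularization carrier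

/-- The discrete desingularizations of a singular space. -/
def SingularSpace.IsDesingularization (S : SingularSpace.{u})
    (D : DiscreteDesingularization S.carrier) : Prop :=
  D.Equivalent S.ref

/-! ### Measurable fields of Hilbert spaces and unitary representations -/

/-- A measurable field of separable complex Hilbert spaces, given by a fundamental sequence of
sections. -/
structure HilbertField (X : Type u) [MeasurableSpace X] where
  fiber : X → Type u
  [normed : ∀ x, NormedAddCommGroup (fiber x)]
  [innerProduct : ∀ x, InnerProductSpace ℂ (fiber x)]
  [complete : ∀ x, CompleteSpace (fiber x)]
  fundamental : ℕ → ∀ x, fiber x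
  measurable_inner : ∀ m n : ℕ,
    Measurable fun x => Inner.inner ℂ (fundamental m x) (fundamental n x)
  dense_span : ∀ x,
    Dense (Submodule.span ℂ (Set.range fun n => fundamental n x) : Set (fiber x))

attribute [instance] HilbertField.normed HilbertField.innerProduct HilbertField.complete

/-- Measurable sections (vector fields) of a measurable field of Hilbert spaces. -/
def HilbertField.MeasurableSection {X : Type u} [MeasurableSpace X] (H : HilbertField X)
    (ξ : ∀ x, H.fiber x) : Prop :=
  ∀ n : ℕ, Measurable fun x => Inner.inner ℂ (H.fundamental n x) (ξ x)

namespace DiscreteDesingularization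

variable {Q : Type u}

/-- A unitary representation of the relation on a measurable field of Hilbert spaces:
`op x y : H y → H x` is unitary for `x ∼ y`. -/
structure UnitaryRep (D : DiscreteDesingularization Q) (H : HilbertField D.X) where
  op : ∀ x y : D.X, D.Rel x y → (H.fiber y ≃ₗᵢ[ℂ] H.fiber x)
  op_self : ∀ (x : D.X) (v : H.fiber x), op x x (D.rel_refl x) v = v
  op_comp : ∀ (x y z : D.X) (hxy : D.Rel x y) (hyz : D.Rel y z) (v : H.fiber z),
    op x z (hxy.trans' hyz) v = op x y hxy (op y z hyz v)
  measurable_coeff : ∀ ξ η : (∀ x, H.fiber x), H.MeasurableSection ξ → H.MeasurableSection η →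
    Measurable fun z : {z : D.X × D.X // D.Rel z.1 z.2} =>
      Inner.inner ℂ (η z.1.1) (op z.1.1 z.1.2 z.2 (ξ z.1.2))

/-- The representation almost has invariant fields: there are measurable fields `ξ n` of unit
vectors, an increasing exhaustion `K n` of the relation and `ε n → 0` such that
`‖π(x,y) ξ n y - ξ n x‖ ≤ ε n` on `K n`. -/
def UnitaryRep.AlmostHasInvariantFields {D : DiscreteDesingularization Q} {H : HilbertField D.X}
    (π : D.UnitaryRep H) : Prop :=
  ∃ (ξ : ℕ → ∀ x, H.fiber x) (K : ℕ → Set (D.X × D.X)) (ε : ℕ → ℝ),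
    (∀ n, H.MeasurableSection (ξ n)) ∧
    (∀ n, ∀ᵐ x ∂D.μ, ‖ξ n x‖ = 1) ∧
    (∀ n, MeasurableSet (K n)) ∧
    (∀ n, ∀ z ∈ K n, D.Rel z.1 z.2) ∧
    Monotone K ∧
    (D.AEPair fun x y _ => ∃ n, (x, y) ∈ K n) ∧
    Tendsto ε atTop (𝓝 0) ∧
    ∀ n, D.AEPair fun x y h => (x, y) ∈ K n → ‖π.op x y h (ξ n y) - ξ n x‖ ≤ ε n

/-- The representation has a measurable invariant field of unit vectors. -/
def UnitaryRep.HasInvariantUnitField {D : DiscreteDesingularization Q} {H : HilbertField D.X}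
    (π : D.UnitaryRep H) : Prop :=
  ∃ ξ : ∀ x, H.fiber x,
    H.MeasurableSection ξ ∧ (∀ᵐ x ∂D.μ, ‖ξ x‖ = 1) ∧
      D.AEPair fun x y h => π.op x y h (ξ y) = ξ x

/-- Kazhdan's property T for the measured equivalence relation of a desingularization. -/
def RelPropertyT (D : DiscreteDesingularization Q) : Prop :=
  ∀ (H : HilbertField D.X) (π : D.UnitaryRep H),
    π.AlmostHasInvariantFields → π.HasInvariantUnitField

end DiscreteDesingularization

/-- A singular space has property T if all its discrete desingularizations do. -/
def SingularSpace.PropertyT (S : SingularSpace.{u}) : Prop :=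
  ∀ D : DiscreteDesingularization S.carrier, S.IsDesingularization D → D.RelPropertyT

/-! ### The first eigenvalue of a finite graph -/

/-- The diffusion operator `D_L f (y) = τ(y)⁻¹ ∑_{z ∼ y} f z` of the uniform random walk on a finite
graph, where `τ(y)` is the valency (the value is `0` at a vertex without neighbours). -/
noncomputable def graphDiffusion {V : Type*} (L : SimpleGraph V) (f : V → ℂ) (y : V) : ℂ :=
  ((L.neighborSet y).ncard : ℂ)⁻¹ * ∑ᶠ z ∈ L.neighborSet y, f z

/-- The eigenvalues of the Laplacian `Id - D_L`. -/
def graphSpectrum {V : Type*} (L : SimpleGraph V) : Set ℝ :=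
  {θ | ∃ f : V → ℂ, f ≠ 0 ∧ ∀ y, f y - graphDiffusion L f y = (θ : ℂ) * f y}

/-- `λ₁(L)`: the smallest nonzero eigenvalue of the Laplacian of a (nonempty) finite graph. -/
noncomputable def lambdaOne {V : Type*} (L : SimpleGraph V) : ℝ :=
  sInf {θ ∈ graphSpectrum L | θ ≠ 0}

/-! ### Periodic simplicial complexes of dimension two -/

open Classical in
/-- A simplicial complex of dimension two which is periodic over `Q`, described transversally by
its simplicial desingularization: a Borel simplicial complex with vertex set `X` whose leaves,
i.e. the subcomplexes over the points of `Q`, have as vertices the fibres of `X → Q`. -/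
structure PeriodicTwoComplex {Q : Type u} (D : DiscreteDesingularization Q) where
  complex : AbstractSimplicialComplex D.X
  card_le : ∀ s ∈ complex.faces, s.card ≤ 3
  rel_of_mem : ∀ s ∈ complex.faces, ∀ x ∈ s, ∀ y ∈ s, D.Rel x y
  measurableSet_edges : MeasurableSet {z : D.X × D.X | {z.1, z.2} ∈ complex.faces}
  measurableSet_triangles :
    MeasurableSet {z : D.X × D.X × D.X | {z.1, z.2.1, z.2.2} ∈ complex.faces}

namespace PeriodicTwoComplex

variable {Q : Type u} {D : DiscreteDesingularization Q}

open Classical in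
/-- The 1-skeleton, as a graph on the vertices. -/
def skeleton (C : PeriodicTwoComplex D) : SimpleGraph D.X where
  Adj x y := x ≠ y ∧ {x, y} ∈ C.complex.faces
  symm := ⟨fun x y h => ⟨h.1.symm, by rw [Finset.pair_comm]; exact h.2⟩⟩
  loopless := ⟨fun _ h => h.1 rfl⟩

/-- Almost every leaf is connected: the 1-skeleton is a graphing of the relation. -/
def LeavesConnected (C : PeriodicTwoComplex D) : Prop :=
  D.AEPair fun x y _ => C.skeleton.Reachable x y

/-- The number of simplices at a vertex is (essentially) bounded. -/
def UniformlyLocallyFinite (C : PeriodicTwoComplex D) : Prop :=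
  ∃ N : ℕ, ∀ᵐ x ∂D.μ, {s ∈ C.complex.faces | x ∈ s}.encard ≤ N

open Classical in
/-- The link of the vertex `x`: its vertices are the edges at `x` (recorded by their other end) and
its edges are the triangles at `x`. -/
def link (C : PeriodicTwoComplex D) (x : D.X) : SimpleGraph (C.skeleton.neighborSet x) where
  Adj y z := y ≠ z ∧ {x, y.1, z.1} ∈ C.complex.faces
  symm := ⟨fun y z h => ⟨h.1.symm, by rw [Finset.pair_comm]; exact h.2⟩⟩
  loopless := ⟨fun _ h => h.1 rfl⟩

end PeriodicTwoComplex

/-! For a field ξ of vectors of norm at most 1, let c(x,y) = π(x,y)ξ_y - ξ_x be its coboundary.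
Weight the edges by w(x,y), the number of triangles on the edge (1 if there are none), and let m_x
be the w-mean of c(x,·), the drift. The energy E = ∫ Σ w|c|² splits as E = V + M, where V = ∫ Σ w|c
- m|² and M = ∫ Σ w|m|².

Spectral gap. By the cocycle identity, |c(x,y) - c(x,z)| = |c(y,z)|, so the gap of the link at x
bounds the variance at x by the energy of the edges opposite to x. Integrating, and moving mass from
x to an endpoint of the opposite edge at the cost of one factor b = δ_μ, gives λV ≤ (b/2)E
(`lam_mul_varianceEnergy_le`). Hence M ≥ κE with κ = 1 - b/(2λ) > 0, and b²V ≤ E because λ > b³/2.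

Contraction. Replace ξ by ξ + tm. Mass transport turns the first order change of the energy into
-2t(∫ Σ δ(y,x) w Re⟨c,m⟩ + M). If δ = 1 this is -4tM. In general, polarization
(`le_edgeIntegral_inner_drift`) leaves an error (b - 1/b)V/4, which b²V ≤ V + M lets M absorb. So
for a suitable fixed t one step multiplies the energy by a factor less than 1
(`energy_averaging_le`).

Limit. The iterates converge almost everywhere to an invariant field, along a path whose mean length
is at most a constant times √E(ξ). Almost invariant fields have energy tending to 0, so their limits
have almost nowhere a common zero, and they are glued into an invariant unit field (`relPropertyT`).

All desingularizations. Property T passes between equivalent desingularizations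
(`RelPropertyT.of_equivalent`) by pulling representations back along Borel maps that cover the
identity of Q almost everywhere. These come from the selection theorem
`exists_measurable_ae_selection`. -/

/-! ### Almost everywhere measurable selections -/

section Selection

/-- The box of sequences dominated by `k` in the first `n` places. -/
def truncatedBox (k : ℕ → ℕ) (n : ℕ) : Set (ℕ → ℕ) := {α | ∀ i < n, α i ≤ k i}

/-- Capacitability argument: the bounds are fixed one coordinate at a time. Relaxing the bound on
the next coordinate exhausts the current box, and outer measure is continuous along increasing
unions even of non-measurable sets. -/
theorem exists_box_measure_gt {X : Type*} [MeasurableSpace X] (μ : Measure X)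
    (g : (ℕ → ℕ) → X) {c : ℝ≥0∞} (hc : c < μ (Set.range g)) :
    ∃ k : ℕ → ℕ, ∀ n, c < μ (g '' truncatedBox k n) := by
  have step : ∀ n (k : ℕ → ℕ), c < μ (g '' truncatedBox k n) →
      ∃ j, c < μ (g '' truncatedBox (Function.update k n j) (n + 1)) := by
    intro n k hk
    have hU : g '' truncatedBox k n =
        ⋃ j, g '' truncatedBox (Function.update k n j) (n + 1) := by
      rw [← Set.image_iUnion]
      congr 1
      ext α
      simp only [truncatedBox, Set.mem_ofPred_eq, Set.mem_iUnion]
      constructor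
      · intro h
        refine ⟨α n, fun i hi => ?_⟩
        rcases Nat.lt_succ_iff_lt_or_eq.1 hi with hi | rfl
        · rw [Function.update_of_ne hi.ne]; exact h i hi
        · simp
      · rintro ⟨j, h⟩ i hi
        have := h i (by omega)
        rwa [Function.update_of_ne hi.ne] at this
    have hmono : Monotone fun j => g '' truncatedBox (Function.update k n j) (n + 1) := by
      intro a b hab
      refine Set.image_mono fun α h i hi => ?_
      rcases Nat.lt_succ_iff_lt_or_eq.1 hi with hi' | rfl
      · have := h i hi
        rw [Function.update_of_ne hi'.ne] at this ⊢; exact this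
      · have := h i hi
        rw [Function.update_self] at this ⊢; exact this.trans hab
    rw [hU, hmono.measure_iUnion, lt_iSup_iff] at hk
    exact hk
  have h0 : c < μ (g '' truncatedBox 0 0) := by
    have : truncatedBox 0 0 = Set.univ := by ext; simp [truncatedBox]
    rwa [this, Set.image_univ]
  choose J hJ using step
  let K : ∀ n, {k : ℕ → ℕ // c < μ (g '' truncatedBox k n)} := fun n =>
    Nat.rec ⟨0, h0⟩ (fun n k => ⟨Function.update k.1 n (J n k.1 k.2), hJ n k.1 k.2⟩) n
  have hK : ∀ n, (K (n + 1)).1 = Function.update (K n).1 n (J n (K n).1 (K n).2) := fun n => rfl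
  -- Stage n changes only coordinate n, so the diagonal sequence agrees with stage n on the first n
  -- coordinates.
  have agree : ∀ i n, i < n → (K n).1 i = (K (i + 1)).1 i := by
    intro i n hin
    induction n, hin using Nat.le_induction with
    | base => rfl
    | succ n hn ih => rw [hK n, Function.update_of_ne (by omega), ih]
  refine ⟨fun i => (K (i + 1)).1 i, fun n => ?_⟩
  have : truncatedBox (fun i => (K (i + 1)).1 i) n = truncatedBox (K n).1 n := by
    ext α
    simp only [truncatedBox, Set.mem_ofPred_eq]
    exact forall₂_congr fun i hi => by rw [agree i n hi]
  rw [this]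
  exact (K n).2

theorem isCompact_box (k : ℕ → ℕ) : IsCompact {α : ℕ → ℕ | ∀ i, α i ≤ k i} := by
  have : {α : ℕ → ℕ | ∀ i, α i ≤ k i} = Set.univ.pi fun i => Set.Iic (k i) := by
    ext; simp [Pi.le_def]
  rw [this]
  exact isCompact_univ_pi fun i => (Set.finite_Iic _).isCompact

/-- An open set which contains a box contains a truncated box. -/
theorem exists_truncatedBox_subset (k : ℕ → ℕ) {U : Set (ℕ → ℕ)} (hU : IsOpen U)
    (hk : {α : ℕ → ℕ | ∀ i, α i ≤ k i} ⊆ U) : ∃ n, truncatedBox k n ⊆ U := by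
  by_contra! h
  have h' : ∀ n, ∃ α, α ∈ truncatedBox k n ∧ α ∉ U := fun n => Set.not_subset.1 (h n)
  choose α hα hαU using h'
  -- At coordinate i only the finitely many terms with n ≤ i can exceed `k i`. Adding them to the
  -- bound puts the whole sequence in one compact box.
  let b : ℕ → ℕ := fun i => k i + ∑ n ∈ Finset.range (i + 1), α n i
  have hb : ∀ n, α n ∈ {β : ℕ → ℕ | ∀ i, β i ≤ b i} := by
    intro n i
    by_cases hin : i < n
    · exact (hα n i hin).trans (Nat.le_add_right _ _)
    · exact (Finset.single_le_sum (f := fun n => α n i) (fun _ _ => Nat.zero_le _)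
        (Finset.mem_range.2 (by omega))).trans (Nat.le_add_left _ _)
  obtain ⟨β, -, φ, hφ, hlim⟩ := (isCompact_box b).tendsto_subseq hb
  have hβ : β ∈ U := by
    refine hk fun i => ?_
    have hi : Tendsto (fun n => α (φ n) i) atTop (𝓝 (β i)) :=
      ((continuous_apply i).tendsto β).comp hlim
    refine le_of_tendsto hi ?_
    filter_upwards [eventually_gt_atTop i] with n hn
    exact hα (φ n) i (hn.trans_le (hφ.id_le n))
  obtain ⟨n, hn⟩ := (hlim.eventually (hU.mem_nhds hβ)).exists
  exact hαU _ hn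

/-- By outer regularity it suffices to test open neighbourhoods of the image of the compact box, and
each of these already contains the image of a truncated box. -/
theorem exists_compact_image_measure_ge {X : Type*} [TopologicalSpace X] [MeasurableSpace X]
    (μ : Measure X) [μ.OuterRegular] {g : (ℕ → ℕ) → X} (hg : Continuous g) {c : ℝ≥0∞}
    (hc : c < μ (Set.range g)) : ∃ C : Set (ℕ → ℕ), IsCompact C ∧ c ≤ μ (g '' C) := by
  obtain ⟨k, hk⟩ := exists_box_measure_gt μ g hc
  refine ⟨_, isCompact_box k, ?_⟩
  rw [Set.measure_eq_iInf_isOpen]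
  refine le_iInf₂ fun U hU => le_iInf fun hUo => ?_
  obtain ⟨n, hn⟩ := exists_truncatedBox_subset k (hUo.preimage hg) (Set.image_subset_iff.1 hU)
  exact (hk n).le.trans (measure_mono (Set.image_subset_iff.2 hn))

/-- A continuous map on a compact set of sequences has a measurable section. -/
theorem exists_measurable_section_of_isCompact {X : Type*} [TopologicalSpace X] [T2Space X]
    [MeasurableSpace X] [BorelSpace X] {C : Set (ℕ → ℕ)} (hC : IsCompact C) {g : (ℕ → ℕ) → X}
    (hg : Continuous g) : ∃ s : X → (ℕ → ℕ), Measurable s ∧ ∀ x ∈ g '' C, g (s x) = x := by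
  classical
  rcases C.eq_empty_or_nonempty with rfl | hne
  · exact ⟨fun _ => 0, measurable_const, by simp⟩
  have := hne.to_subtype
  have := isCompact_iff_compactSpace.1 hC
  let : MetricSpace C := TopologicalSpace.metrizableSpaceMetric C
  obtain ⟨e, he, hes⟩ := exists_nat_bool_continuous_surjective_of_compact C
  let h : cantorSet → C := e ∘ cantorSetHomeomorphNatToBool
  have hh : Continuous h := he.comp cantorSetHomeomorphNatToBool.continuous
  have hhs : Function.Surjective h := hes.comp cantorSetHomeomorphNatToBool.surjective
  let F : cantorSet → X := fun t => g (h t).1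
  have hF : Continuous F := hg.comp (continuous_subtype_val.comp hh)
  have hcc : CompactSpace cantorSet := isCompact_iff_compactSpace.1 isCompact_cantorSet
  have hrange : Set.range F = g '' C := by
    ext x
    constructor
    · rintro ⟨t, rfl⟩; exact ⟨_, (h t).2, rfl⟩
    · rintro ⟨a, ha, rfl⟩
      obtain ⟨t, ht⟩ := hhs ⟨a, ha⟩
      exact ⟨t, by simp [F, ht]⟩
  -- Parametrizing by a compact subset of ℝ singles out one point in each fibre: the least one.
  have hmin : ∀ x ∈ g '' C, ∃ t : cantorSet, F t = x ∧ ∀ t', F t' = x → t ≤ t' := by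
    intro x hx
    rw [← hrange] at hx
    have hK : IsCompact (F ⁻¹' {x}) := (isClosed_singleton.preimage hF).isCompact
    obtain ⟨t, ht, hm⟩ := hK.exists_isMinOn (f := fun t : cantorSet => (t : ℝ))
      (by obtain ⟨t, rfl⟩ := hx; exact ⟨t, rfl⟩) continuous_subtype_val.continuousOn
    exact ⟨t, ht, fun t' ht' => hm ht'⟩
  have hclosed : IsClosed (g '' C) := (hC.image hg).isClosed
  obtain ⟨a0⟩ : Nonempty cantorSet := ⟨⟨0, zero_mem_cantorSet⟩⟩
  let s : X → cantorSet := fun x => if hx : x ∈ g '' C then (hmin x hx).choose else a0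
  have hs : Measurable s := by
    refine Measurable.dite (s := g '' C) (f := fun x : {x // x ∈ g '' C} => (hmin x.1 x.2).choose)
      (g := fun _ => a0) ?_ measurable_const hclosed.measurableSet
    refine Measurable.subtype_mk (f := fun x : {x // x ∈ g '' C} =>
      ((hmin x.1 x.2).choose : ℝ)) (measurable_of_Iic fun a => ?_)
    -- The sublevel sets of the least point are continuous images of compact sets, hence closed.
    have : (fun x : {x // x ∈ g '' C} => ((hmin x.1 x.2).choose : ℝ)) ⁻¹' Set.Iic a =
        Subtype.val ⁻¹' (F '' {t | (t : ℝ) ≤ a}) := by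
      ext x
      have hx := (hmin x.1 x.2).choose_spec
      constructor
      · intro h; exact ⟨_, h, hx.1⟩
      · rintro ⟨t, ht, hxt⟩
        exact (Subtype.coe_le_coe.2 (hx.2 t hxt)).trans ht
    rw [this]
    refine measurable_subtype_coe (IsClosed.measurableSet ?_)
    exact ((isClosed_Iic.preimage continuous_subtype_val).isCompact.image hF).isClosed
  refine ⟨fun x => (h (s x)).1, ?_, fun x hx => ?_⟩
  · exact (measurable_subtype_coe.comp hh.measurable).comp hs
  · have : s x = (hmin x hx).choose := dif_pos hx
    change F (s x) = x
    rw [this]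
    exact (hmin x hx).choose_spec.1

/-- A Borel set almost all of whose sections are nonempty contains the graph of a Borel map over a
conull set. -/
theorem exists_measurable_ae_selection {X Y : Type*} [MeasurableSpace X] [StandardBorelSpace X]
    [MeasurableSpace Y] [StandardBorelSpace Y] [Nonempty Y] (μ : Measure X) [IsFiniteMeasure μ]
    {Z : Set (X × Y)} (hZ : MeasurableSet Z) (hne : ∀ᵐ x ∂μ, ∃ y, (x, y) ∈ Z) :
    ∃ f : X → Y, Measurable f ∧ ∀ᵐ x ∂μ, (x, f x) ∈ Z := by
  classical
  let := upgradeStandardBorel X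
  let := upgradeStandardBorel Y
  have hA := hZ.analyticSet
  rw [AnalyticSet] at hA
  rcases hA with rfl | ⟨F, hF, rfl⟩
  · refine ⟨fun _ => Classical.arbitrary Y, measurable_const, ?_⟩
    filter_upwards [hne] with x hx
    simp at hx
  let g : (ℕ → ℕ) → X := fun α => (F α).1
  have hg : Continuous g := continuous_fst.comp hF
  have hfull : μ (Set.range g) = μ Set.univ := by
    refine measure_congr ?_
    filter_upwards [hne] with x hx
    obtain ⟨y, α, hα⟩ := hx
    exact propext ⟨fun _ => trivial, fun _ => ⟨α, by simp [g, hα]⟩⟩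
  -- Selections exist over Borel sets of measure arbitrarily close to the total mass; countably many
  -- are then glued.
  have key : ∀ c : ℝ≥0∞, c < μ Set.univ → ∃ (B : Set X) (f : X → Y), MeasurableSet B ∧
      Measurable f ∧ c ≤ μ B ∧ ∀ x ∈ B, (x, f x) ∈ Set.range F := by
    intro c hc
    rw [← hfull] at hc
    obtain ⟨C, hC, hcC⟩ := exists_compact_image_measure_ge μ hg hc
    obtain ⟨s, hs, hsC⟩ := exists_measurable_section_of_isCompact hC hg
    refine ⟨g '' C, fun x => (F (s x)).2, (hC.image hg).isClosed.measurableSet,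
      measurable_snd.comp (hF.measurable.comp hs), hcC, fun x hx => ⟨s x, ?_⟩⟩
    exact Prod.ext (hsC x hx) rfl
  rcases eq_or_ne (μ Set.univ) 0 with h0 | h0
  · refine ⟨fun _ => Classical.arbitrary Y, measurable_const, ?_⟩
    rw [Measure.measure_univ_eq_zero] at h0
    simp [h0]
  obtain ⟨c, -, hcl, hct⟩ := exists_seq_strictMono_tendsto' (pos_iff_ne_zero.2 h0)
  choose B f hB hf hcB hBf using fun n => key (c n) (hcl n).2
  have hU : μ (⋃ n, B n)ᶜ = 0 := by
    rw [measure_compl (MeasurableSet.iUnion hB) (measure_ne_top _ _), tsub_eq_zero_iff_le]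
    exact le_of_tendsto' hct fun n => (hcB n).trans (measure_mono (Set.subset_iUnion B n))
  -- The second alternative only supplies an index on the null set that no `B n` covers.
  have hex : ∀ x, ∃ n, x ∈ B n ∨ x ∈ (⋃ n, B n)ᶜ := by
    intro x
    by_cases hx : x ∈ ⋃ n, B n
    · obtain ⟨n, hn⟩ := Set.mem_iUnion.1 hx; exact ⟨n, Or.inl hn⟩
    · exact ⟨0, Or.inr hx⟩
  refine ⟨fun x => f (Nat.find (hex x)) x, ?_, ?_⟩
  · exact Measurable.find (p := fun n x => x ∈ B n ∨ x ∈ (⋃ n, B n)ᶜ) hf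
      (fun n => (hB n).union (MeasurableSet.iUnion hB).compl) hex
  · filter_upwards [compl_mem_ae_iff.2 hU] with x hx
    rcases Nat.find_spec (hex x) with h | h
    · exact hBf _ x h
    · exact absurd h hx

end Selection

/-! ### Borel sets with finite sections of bounded size -/

section FiniteSections

/-- Induction on the bound. A section with the maximal number of points has exactly one increasing
enumeration, so the set of such x is an injective Borel image, hence Borel by Lusin–Souslin.
Removing it lowers the bound. -/
theorem measurableSet_encard_section_eq_of_real {X : Type*} [MeasurableSpace X]
    [StandardBorelSpace X] (N : ℕ) {K : Set (X × ℝ)} (hK : MeasurableSet K)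
    (hN : ∀ x, {y | (x, y) ∈ K}.encard ≤ N) (j : ℕ∞) :
    MeasurableSet {x | {y | (x, y) ∈ K}.encard = j} := by
  induction N generalizing K with
  | zero =>
    have : ∀ x, {y | (x, y) ∈ K}.encard = 0 := fun x => nonpos_iff_eq_zero.1 (by simpa using hN x)
    simp only [this]
    exact MeasurableSet.const _
  | succ N ih =>
    have hS : MeasurableSet {x | {y | (x, y) ∈ K}.encard = (N + 1 : ℕ)} := by
      let P : Set (X × (Fin (N + 1) → ℝ)) := {p | StrictMono p.2 ∧ ∀ i, (p.1, p.2 i) ∈ K}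
      have hP : MeasurableSet P := by
        refine MeasurableSet.inter ?_ ?_
        · have : {p : X × (Fin (N + 1) → ℝ) | StrictMono p.2} =
              ⋂ i, ⋂ j, ⋂ _ : i < j, {p | p.2 i < p.2 j} := by
            ext p; simp [StrictMono]
          change MeasurableSet {p : X × (Fin (N + 1) → ℝ) | StrictMono p.2}
          rw [this]
          refine MeasurableSet.iInter fun i => MeasurableSet.iInter fun j =>
            MeasurableSet.iInter fun _ => measurableSet_lt ?_ ?_
          · exact (measurable_pi_apply i).comp measurable_snd
          · exact (measurable_pi_apply j).comp measurable_snd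
        · have : {p : X × (Fin (N + 1) → ℝ) | ∀ i, (p.1, p.2 i) ∈ K} =
              ⋂ i, (fun p : X × (Fin (N + 1) → ℝ) => (p.1, p.2 i)) ⁻¹' K := by
            ext p; simp
          change MeasurableSet {p : X × (Fin (N + 1) → ℝ) | ∀ i, (p.1, p.2 i) ∈ K}
          rw [this]
          exact MeasurableSet.iInter fun i =>
            (measurable_fst.prodMk ((measurable_pi_apply i).comp measurable_snd)) hK
      have huniq : ∀ x (y : Fin (N + 1) → ℝ), (x, y) ∈ P →
          ∃ (s : Finset ℝ) (h : s.card = N + 1), (s : Set ℝ) = {y | (x, y) ∈ K} ∧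
            y = s.orderEmbOfFin h := by
        rintro x y ⟨hy, hyK⟩
        have hfin : {y | (x, y) ∈ K}.Finite :=
          Set.finite_of_encard_le_coe (hN x)
        have hcard : hfin.toFinset.card = N + 1 := by
          apply le_antisymm
          · have := hN x
            rw [hfin.encard_eq_coe_toFinset_card] at this
            exact_mod_cast this
          · have h1 : (Finset.univ.image y) ⊆ hfin.toFinset := by
              intro t ht
              obtain ⟨i, -, rfl⟩ := Finset.mem_image.1 ht
              exact hfin.mem_toFinset.2 (hyK i)
            have := Finset.card_le_card h1
            rwa [Finset.card_image_of_injective _ hy.injective, Finset.card_univ,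
              Fintype.card_fin] at this
        exact ⟨_, hcard, hfin.coe_toFinset, Finset.orderEmbOfFin_unique hcard
          (fun i => hfin.mem_toFinset.2 (hyK i)) hy⟩
      have himg : {x | {y | (x, y) ∈ K}.encard = (N + 1 : ℕ)} = Prod.fst '' P := by
        ext x
        constructor
        · intro hx
          have hx' : {y | (x, y) ∈ K}.encard = (N + 1 : ℕ) := hx
          have hfin : {y | (x, y) ∈ K}.Finite := Set.finite_of_encard_eq_coe hx'
          have hcard : hfin.toFinset.card = N + 1 := by
            rw [hfin.encard_eq_coe_toFinset_card] at hx'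
            exact_mod_cast hx'
          exact ⟨(x, hfin.toFinset.orderEmbOfFin hcard),
            ⟨(hfin.toFinset.orderEmbOfFin hcard).strictMono, fun i =>
              hfin.mem_toFinset.1 (Finset.orderEmbOfFin_mem _ hcard i)⟩, rfl⟩
        · rintro ⟨⟨x, y⟩, hp, rfl⟩
          obtain ⟨s, hs, hsK, -⟩ := huniq x y hp
          change {y | (x, y) ∈ K}.encard = (N + 1 : ℕ)
          rw [← hsK, Set.encard_coe_eq_coe_finsetCard, hs]
      rw [himg]
      refine hP.image_of_measurable_injOn measurable_fst ?_
      rintro ⟨x, y⟩ hp ⟨x', y'⟩ hp' hxx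
      obtain rfl : x = x' := hxx
      obtain ⟨s, hs, hsK, rfl⟩ := huniq x y hp
      obtain ⟨s', hs', hsK', rfl⟩ := huniq x y' hp'
      obtain rfl : s = s' := Finset.coe_injective (hsK.trans hsK'.symm)
      rfl
    set S := {x | {y | (x, y) ∈ K}.encard = (N + 1 : ℕ)} with hSdef
    have hmemS : ∀ x, x ∈ S ↔ {y | (x, y) ∈ K}.encard = (N + 1 : ℕ) := fun x => Iff.rfl
    by_cases hj : j = (N + 1 : ℕ)
    · rw [hj]; exact hS
    have hsec : ∀ x ∉ S, {y | (x, y) ∈ K ∩ Sᶜ ×ˢ Set.univ} = {y | (x, y) ∈ K} := by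
      intro x hx
      ext y
      simp [hx]
    have hK' := ih (K := K ∩ Sᶜ ×ˢ Set.univ) (hK.inter (hS.compl.prod MeasurableSet.univ)) (by
      intro x
      by_cases hx : x ∈ S
      · have : {y | (x, y) ∈ K ∩ Sᶜ ×ˢ Set.univ} = ∅ := by ext y; simp [hx]
        rw [this]; simp
      · rw [hsec x hx]
        have h1 := hN x
        have h2 : {y | (x, y) ∈ K}.encard < (N + 1 : ℕ) := lt_of_le_of_ne h1 hx
        rw [Nat.cast_add, Nat.cast_one] at h2
        exact Order.le_of_lt_add_one h2)
    have : {x | {y | (x, y) ∈ K}.encard = j} =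
        Sᶜ ∩ {x | {y | (x, y) ∈ K ∩ Sᶜ ×ˢ Set.univ}.encard = j} := by
      ext x
      by_cases hx : x ∈ S
      · simp only [Set.mem_ofPred_eq, Set.mem_inter_iff, Set.mem_compl_iff, hx, not_true,
          false_and, iff_false, (hmemS x).1 hx]
        exact fun h => hj h.symm
      · rw [Set.mem_inter_iff, Set.mem_ofPred_eq, Set.mem_ofPred_eq, hsec x hx]
        simp [hx]
    rw [this]
    exact hS.compl.inter hK'

variable {X Y : Type*} [MeasurableSpace X] [StandardBorelSpace X] [MeasurableSpace Y]
  [StandardBorelSpace Y]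

theorem measurableSet_encard_section_eq (N : ℕ) {K : Set (X × Y)} (hK : MeasurableSet K)
    (hN : ∀ x, {y | (x, y) ∈ K}.encard ≤ N) (j : ℕ∞) :
    MeasurableSet {x | {y | (x, y) ∈ K}.encard = j} := by
  have hφ := measurableEmbedding_embeddingReal Y
  have hsec : ∀ x, {t | (x, t) ∈ Prod.map id (embeddingReal Y) '' K} =
      embeddingReal Y '' {y | (x, y) ∈ K} := by
    intro x
    ext t
    constructor
    · rintro ⟨⟨x', y⟩, h, he⟩
      obtain ⟨rfl, rfl⟩ := Prod.mk.inj he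
      exact ⟨y, h, rfl⟩
    · rintro ⟨y, h, rfl⟩
      exact ⟨(x, y), h, rfl⟩
  have hcard : ∀ x, {t | (x, t) ∈ Prod.map id (embeddingReal Y) '' K}.encard =
      {y | (x, y) ∈ K}.encard := fun x => by rw [hsec, hφ.injective.encard_image]
  have := measurableSet_encard_section_eq_of_real N
    ((MeasurableEmbedding.id.prodMap hφ).measurableSet_image.2 hK)
    (fun x => (hcard x).trans_le (hN x)) j
  simpa only [hcard] using this

/-- The kernel `x ↦` counting measure on the finite set `nb x`. -/
noncomputable def countingKernel (nb : X → Finset Y) {N : ℕ}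
    (hnb : MeasurableSet {p : X × Y | p.2 ∈ nb p.1}) (hN : ∀ x, (nb x).card ≤ N) :
    ProbabilityTheory.Kernel X Y where
  toFun x := ∑ y ∈ nb x, Measure.dirac y
  measurable' := by
    refine Measure.measurable_of_measurable_coe _ fun A hA => ?_
    have hK : MeasurableSet ({p : X × Y | p.2 ∈ nb p.1} ∩ Prod.snd ⁻¹' A) :=
      hnb.inter (measurable_snd hA)
    have hle : ∀ x, {y | (x, y) ∈ {p : X × Y | p.2 ∈ nb p.1} ∩ Prod.snd ⁻¹' A}.encard ≤ N := by
      intro x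
      calc _ ≤ (nb x : Set Y).encard := Set.encard_le_encard fun y hy => hy.1
        _ ≤ N := by rw [Set.encard_coe_eq_coe_finsetCard]; exact_mod_cast hN x
    have hval : ∀ x, (∑ y ∈ nb x, Measure.dirac y : Measure Y) A =
        (({y | (x, y) ∈ {p : X × Y | p.2 ∈ nb p.1} ∩ Prod.snd ⁻¹' A}.encard : ℕ∞) : ℝ≥0∞) := by
      intro x
      classical
      have h1 : {y | (x, y) ∈ {p : X × Y | p.2 ∈ nb p.1} ∩ Prod.snd ⁻¹' A} =
          (((nb x).filter (· ∈ A) : Finset Y) : Set Y) := by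
        ext y; simp
      rw [h1, Set.encard_coe_eq_coe_finsetCard, Measure.coe_finsetSum, Finset.sum_apply]
      simp [Measure.dirac_apply, Set.indicator_apply, Finset.sum_boole]
    simp only [hval]
    refine (measurable_from_top (f := fun n : ℕ∞ => (n : ℝ≥0∞))).comp ?_
    exact measurable_to_countable' fun j => measurableSet_encard_section_eq N hK hle j

variable {nb : X → Finset Y} {N : ℕ}

theorem isFiniteKernel_countingKernel (hnb : MeasurableSet {p : X × Y | p.2 ∈ nb p.1})
    (hN : ∀ x, (nb x).card ≤ N) :
    ProbabilityTheory.IsFiniteKernel (countingKernel nb hnb hN) := by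
  refine ⟨⟨N, by simp, fun x => ?_⟩⟩
  change (∑ y ∈ nb x, Measure.dirac y : Measure Y) Set.univ ≤ N
  rw [Measure.coe_finsetSum, Finset.sum_apply]
  simpa using hN x

/-- The sum is an integral against the counting kernel, and integrals of jointly measurable
functions against a finite kernel are measurable in the parameter. -/
theorem measurable_sum_section_ennreal (hnb : MeasurableSet {p : X × Y | p.2 ∈ nb p.1})
    (hN : ∀ x, (nb x).card ≤ N) {f : X × Y → ℝ≥0∞} (hf : Measurable f) :
    Measurable fun x => ∑ y ∈ nb x, f (x, y) := by
  have := isFiniteKernel_countingKernel hnb hN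
  have h := hf.lintegral_kernel_prod_right' (κ := countingKernel nb hnb hN)
  convert h using 2 with x
  change _ = ∫⁻ y, f (x, y) ∂(∑ y ∈ nb x, Measure.dirac y : Measure Y)
  simp

theorem measurable_sum_section {E : Type*} [NormedAddCommGroup E] [NormedSpace ℝ E]
    [MeasurableSpace E] [BorelSpace E] [SecondCountableTopology E] [CompleteSpace E]
    (hnb : MeasurableSet {p : X × Y | p.2 ∈ nb p.1})
    (hN : ∀ x, (nb x).card ≤ N) {f : X × Y → E} (hf : Measurable f) :
    Measurable fun x => ∑ y ∈ nb x, f (x, y) := by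
  have := isFiniteKernel_countingKernel hnb hN
  have h := (hf.stronglyMeasurable.integral_kernel_prod_right'
    (κ := countingKernel nb hnb hN)).measurable
  convert h using 2 with x
  change _ = ∫ y, f (x, y) ∂(∑ y ∈ nb x, Measure.dirac y : Measure Y)
  rw [integral_finsetSum_measure]
  · simp
  · intro y _
    exact integrable_dirac (by simp)

end FiniteSections

/-! ### Measurable sections of fields of Hilbert spaces -/

namespace HilbertField

variable {X Y : Type u} [MeasurableSpace X] [MeasurableSpace Y]

/-- The pullback of a measurable field under a measurable map. -/
def comap (H : HilbertField X) (α : Y → X) (hα : Measurable α) : HilbertField Y where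
  fiber y := H.fiber (α y)
  normed y := H.normed (α y)
  innerProduct y := H.innerProduct (α y)
  complete y := H.complete (α y)
  fundamental n y := H.fundamental n (α y)
  measurable_inner m n := (H.measurable_inner m n).comp hα
  dense_span y := H.dense_span (α y)

variable (H : HilbertField X)

theorem measurableSection_comap {α : Y → X} (hα : Measurable α) {ξ : ∀ x, H.fiber x}
    (hξ : H.MeasurableSection ξ) : (H.comap α hα).MeasurableSection fun y => ξ (α y) :=
  fun n => (hξ n).comp hα

/-- The combination of the first fundamental sections with the given constant coefficients. -/
noncomputable def combination (c : Σ n, Fin n → ℕ) (x : X) : H.fiber x :=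
  ∑ i : Fin c.1, TopologicalSpace.denseSeq ℂ (c.2 i) • H.fundamental i x

/-- An enumeration of the index set of the combinations. -/
noncomputable def combinationIndex : ℕ → Σ n, Fin n → ℕ :=
  (exists_surjective_nat (Σ n, Fin n → ℕ)).choose

theorem combinationIndex_surjective : Function.Surjective combinationIndex :=
  (exists_surjective_nat (Σ n, Fin n → ℕ)).choose_spec

/-- The index set is countable and independent of x, so an approximating combination can be chosen
measurably in x. -/
theorem denseRange_combination (x : X) : DenseRange fun c => H.combination c x := by
  refine Metric.dense_iff.2 fun v r hr => ?_
  obtain ⟨w, hw, hwv⟩ := Metric.dense_iff.1 (H.dense_span x) v r hr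
  obtain ⟨l, rfl⟩ := (Finsupp.mem_span_range_iff_exists_finsupp).1 hwv
  obtain ⟨n, hn⟩ : ∃ n, l.support ⊆ Finset.range n :=
    ⟨l.support.sup id + 1, fun i hi => Finset.mem_range.2
      (Nat.lt_succ_of_le (Finset.le_sup (f := id) hi))⟩
  have hsum : (l.sum fun i a => a • H.fundamental i x) =
      ∑ i : Fin n, l i • H.fundamental i x := by
    rw [Fin.sum_univ_eq_sum_range (fun i => l i • H.fundamental i x) n]
    exact Finset.sum_subset hn fun i _ hi => by simp [Finsupp.notMem_support_iff.1 hi]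
  rw [hsum] at hw
  let F : (Fin n → ℂ) → H.fiber x := fun a => ∑ i, a i • H.fundamental i x
  have hF : Continuous F := by fun_prop
  have hdense : DenseRange fun (c : Fin n → ℕ) i => TopologicalSpace.denseSeq ℂ (c i) :=
    DenseRange.piMap fun _ => TopologicalSpace.denseRange_denseSeq ℂ
  obtain ⟨c, hc⟩ := hdense.exists_mem_open (Metric.isOpen_ball.preimage hF)
    ⟨fun i => l i, hw⟩
  exact ⟨_, hc, ⟨⟨n, c⟩, rfl⟩⟩

variable {H}

namespace MeasurableSection

variable {ξ η : ∀ x, H.fiber x}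

theorem fundamental (n : ℕ) : H.MeasurableSection (H.fundamental n) :=
  fun m => H.measurable_inner m n

theorem add (hξ : H.MeasurableSection ξ) (hη : H.MeasurableSection η) :
    H.MeasurableSection fun x => ξ x + η x := fun n => by
  simp only [inner_add_right]
  exact (hξ n).add (hη n)

theorem sub (hξ : H.MeasurableSection ξ) (hη : H.MeasurableSection η) :
    H.MeasurableSection fun x => ξ x - η x := fun n => by
  simp only [inner_sub_right]
  exact (hξ n).sub (hη n)

theorem smul (hξ : H.MeasurableSection ξ) {a : X → ℂ} (ha : Measurable a) :
    H.MeasurableSection fun x => a x • ξ x := fun n => by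
  simp only [inner_smul_right]
  exact ha.mul (hξ n)

theorem sum {ι : Type*} (s : Finset ι) {ζ : ι → ∀ x, H.fiber x}
    (hζ : ∀ i ∈ s, H.MeasurableSection (ζ i)) :
    H.MeasurableSection fun x => ∑ i ∈ s, ζ i x := fun n => by
  simpa only [inner_sum] using Finset.measurable_fun_sum s fun i hi => hζ i hi n

theorem combination (c : Σ n, Fin n → ℕ) : H.MeasurableSection (H.combination c) :=
  sum _ fun i _ => (fundamental i).smul measurable_const

theorem inner_combination (hξ : H.MeasurableSection ξ) (c : Σ n, Fin n → ℕ) :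
    Measurable fun x => inner ℂ (H.combination c x) (ξ x) := by
  simp only [HilbertField.combination, sum_inner, inner_smul_left]
  exact Finset.measurable_fun_sum _ fun i _ => (hξ i).const_mul _

/-- ‖ξ‖² is the supremum of 2Re⟨v,ξ⟩ - ‖v‖², which equals ‖ξ‖² - ‖ξ - v‖², over the countably many
dense combinations v. -/
theorem sq_norm (hξ : H.MeasurableSection ξ) : Measurable fun x => ‖ξ x‖ ^ 2 := by
  have key : ∀ c x, ‖ξ x‖ ^ 2 - ‖ξ x - H.combination c x‖ ^ 2 =
      2 * (inner ℂ (H.combination c x) (ξ x)).re -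
        (inner ℂ (H.combination c x) (H.combination c x)).re := by
    intro c x
    have h1 := @norm_sub_sq ℂ _ _ _ _ (ξ x) (H.combination c x)
    have h2 := @inner_self_eq_norm_sq ℂ _ _ _ _ (H.combination c x)
    have h3 := @inner_re_symm ℂ _ _ _ _ (ξ x) (H.combination c x)
    simp only [RCLike.re_to_complex] at h1 h2 h3
    rw [h1, h2, h3]
    ring
  refine measurable_of_Iic fun a => ?_
  have : (fun x => ‖ξ x‖ ^ 2) ⁻¹' Set.Iic a = ⋂ c : Σ n, Fin n → ℕ,
      {x | 2 * (inner ℂ (H.combination c x) (ξ x)).re -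
        (inner ℂ (H.combination c x) (H.combination c x)).re ≤ a} := by
    ext x
    simp only [Set.mem_preimage, Set.mem_Iic, Set.mem_iInter, Set.mem_ofPred_eq, ← key]
    refine ⟨fun h c => by nlinarith [sq_nonneg ‖ξ x - H.combination c x‖], fun h => ?_⟩
    have hcont : Continuous fun v : H.fiber x => ‖ξ x‖ ^ 2 - ‖ξ x - v‖ ^ 2 := by fun_prop
    have := (H.denseRange_combination x).induction_on
      (p := fun v => ‖ξ x‖ ^ 2 - ‖ξ x - v‖ ^ 2 ≤ a) (ξ x)
      (isClosed_le hcont continuous_const) h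
    simpa using this
  rw [this]
  refine MeasurableSet.iInter fun c => measurableSet_le ?_ measurable_const
  exact ((Complex.measurable_re.comp (hξ.inner_combination c)).const_mul 2).sub
    (Complex.measurable_re.comp ((combination c).inner_combination c))

protected theorem norm (hξ : H.MeasurableSection ξ) : Measurable fun x => ‖ξ x‖ := by
  have := hξ.sq_norm.sqrt
  simpa only [Real.sqrt_sq (norm_nonneg _)] using this

protected theorem inner (hη : H.MeasurableSection η) (hξ : H.MeasurableSection ξ) :
    Measurable fun x => inner ℂ (η x) (ξ x) := by
  have hI := hξ.smul (measurable_const (a := Complex.I))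
  simp only [inner_eq_sum_norm_sq_div_four (𝕜 := ℂ)]
  have h (ζ : ∀ x, H.fiber x) (hζ : H.MeasurableSection ζ) :
      Measurable fun x => ((‖ζ x‖ : ℝ) : ℂ) ^ 2 :=
    (Complex.measurable_ofReal.comp hζ.norm).pow_const 2
  exact (((h _ (hη.add hξ)).sub (h _ (hη.sub hξ))).add
    (((h _ (hη.sub hI)).sub (h _ (hη.add hI))).mul_const _)).div_const _

/-- A measurable section is the pointwise limit of sections which are locally, over countably many
Borel pieces, combinations of the fundamental ones. -/
theorem exists_approx (hξ : H.MeasurableSection ξ) :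
    ∃ k : ℕ → X → ℕ, (∀ j, Measurable (k j)) ∧
      ∀ x, Tendsto (fun j => H.combination (combinationIndex (k j x)) x) atTop (𝓝 (ξ x)) := by
  classical
  have hex : ∀ (j : ℕ) x, ∃ k, ‖ξ x - H.combination (combinationIndex k) x‖ < 1 / ((j : ℝ) + 1) := by
    intro j x
    obtain ⟨c, hc⟩ := (H.denseRange_combination x).exists_dist_lt (ξ x)
      (Nat.one_div_pos_of_nat (n := j) (α := ℝ))
    obtain ⟨k, rfl⟩ := combinationIndex_surjective c
    exact ⟨k, by rwa [← dist_eq_norm]⟩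
  refine ⟨fun j x => Nat.find (hex j x), fun j => ?_, fun x => ?_⟩
  · exact measurable_find (hex j) fun k =>
      measurableSet_lt (hξ.sub (combination (combinationIndex k))).norm measurable_const
  · rw [tendsto_iff_norm_sub_tendsto_zero]
    refine squeeze_zero (fun _ => norm_nonneg _) (fun j => ?_)
      (tendsto_one_div_add_atTop_nhds_zero_nat (𝕜 := ℝ))
    rw [norm_sub_rev]
    exact (Nat.find_spec (hex j x)).le

end MeasurableSection

end HilbertField

namespace DiscreteDesingularization

/-- Sections of a pulled back field need not be pulled back from sections, so `measurable_coeff`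
does not apply directly. Both sections are approximated by combinations with measurably varying
indices. For constant indices the axiom applies, and the general case is a countable partition
followed by a pointwise limit. -/
theorem UnitaryRep.measurable_coeff_comap {Q Y : Type u} [MeasurableSpace Y]
    {D : DiscreteDesingularization Q} {H : HilbertField D.X} (π : D.UnitaryRep H)
    {α β : Y → D.X} (hα : Measurable α) (hβ : Measurable β) (hr : ∀ y, D.Rel (α y) (β y))
    {ζ : ∀ y, H.fiber (α y)} {θ : ∀ y, H.fiber (β y)}
    (hζ : (H.comap α hα).MeasurableSection ζ) (hθ : (H.comap β hβ).MeasurableSection θ) :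
    Measurable fun y => inner ℂ (ζ y) (π.op (α y) (β y) (hr y) (θ y)) := by
  obtain ⟨k, hk, hkζ⟩ := hζ.exists_approx
  obtain ⟨l, hl, hlθ⟩ := hθ.exists_approx
  refine measurable_of_tendsto_metrizable (f := fun j y => 
    inner ℂ (H.combination (HilbertField.combinationIndex (k j y)) (α y))
    (π.op (α y) (β y) (hr y) (H.combination (HilbertField.combinationIndex (l j y)) (β y)))) (fun j => ?_) ?_
  · let G : (ℕ × ℕ) × Y → ℂ := fun p =>
      inner ℂ (H.combination (HilbertField.combinationIndex p.1.1) (α p.2))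
        (π.op (α p.2) (β p.2) (hr p.2)
        (H.combination (HilbertField.combinationIndex p.1.2) (β p.2)))
    have hG : Measurable G := by
      refine measurable_from_prod_countable_right fun c => ?_
      exact (π.measurable_coeff _ _ 
        (HilbertField.MeasurableSection.combination (HilbertField.combinationIndex c.2))
        (HilbertField.MeasurableSection.combination (HilbertField.combinationIndex c.1))).comp
        (Measurable.subtype_mk (h := hr) (hα.prodMk hβ))
    exact hG.comp (((hk j).prodMk (hl j)).prodMk measurable_id)
  · rw [tendsto_pi_nhds]
    intro y
    exact (hkζ y).inner (((π.op (α y) (β y) (hr y)).continuous.tendsto _).comp (hlθ y))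

end DiscreteDesingularization

/-! ### Invariance of property T under equivalence of desingularizations -/

namespace DiscreteDesingularization

variable {Q : Type u} {A B : DiscreteDesingularization Q}

theorem Rel.symm' {D : DiscreteDesingularization Q} {x y : D.X} (h : D.Rel x y) : D.Rel y x :=
  Eq.symm h

theorem measure_saturation_eq_zero (D : DiscreteDesingularization Q) {N : Set D.X}
    (hN : D.μ N = 0) : D.μ (D.proj ⁻¹' (D.proj '' N)) = 0 :=
  measure_mono_null (Set.preimage_mono (Set.image_mono (subset_toMeasurable D.μ N)))
    (D.quasiInvariant _ (measurableSet_toMeasurable _ _) (by rwa [measure_toMeasurable]))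

theorem ae_forall_rel (D : DiscreteDesingularization Q) {P : D.X → Prop} (h : ∀ᵐ x ∂D.μ, P x) :
    ∀ᵐ x ∂D.μ, ∀ y, D.Rel x y → P y := by
  refine measure_mono_null ?_ (D.measure_saturation_eq_zero h)
  intro x hx
  obtain ⟨y, hxy, hy⟩ : ∃ y, D.Rel x y ∧ ¬ P y := by
    by_contra! hcon
    exact hx hcon
  exact ⟨y, hy, hxy.symm⟩

/-- Saturations and measurable hulls are taken alternately, starting from the bad set. All stages
are null, and their union is both Borel and saturated. -/
theorem exists_invariant_conull (D : DiscreteDesingularization Q) {P : D.X → Prop}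
    (h : ∀ᵐ x ∂D.μ, P x) : ∃ G : Set D.X, MeasurableSet G ∧ (∀ᵐ x ∂D.μ, x ∈ G) ∧
      (∀ x ∈ G, P x) ∧ ∀ x y, D.Rel x y → x ∈ G → y ∈ G := by
  let b : ℕ → Set D.X := fun n => Nat.rec (toMeasurable D.μ {x | ¬ P x})
    (fun _ s => toMeasurable D.μ (D.proj ⁻¹' (D.proj '' s))) n
  have hb : ∀ n, b (n + 1) = toMeasurable D.μ (D.proj ⁻¹' (D.proj '' b n)) := fun _ => rfl
  have hbm : ∀ n, MeasurableSet (b n) := fun n => by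
    cases n <;> exact measurableSet_toMeasurable _ _
  have hb0 : ∀ n, D.μ (b n) = 0 := fun n => by
    induction n with
    | zero => exact (measure_toMeasurable _).trans h
    | succ n ih => rw [hb, measure_toMeasurable]; exact D.measure_saturation_eq_zero ih
  refine ⟨(⋃ n, b n)ᶜ, (MeasurableSet.iUnion hbm).compl, ?_, fun x hx => ?_, fun x y hxy hx hy => ?_⟩
  · exact compl_mem_ae_iff.2 (measure_iUnion_null hb0)
  · by_contra hP
    exact hx (Set.mem_iUnion.2 ⟨0, subset_toMeasurable _ _ hP⟩)
  · obtain ⟨n, hn⟩ := Set.mem_iUnion.1 hy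
    refine hx (Set.mem_iUnion.2 ⟨n + 1, ?_⟩)
    rw [hb]
    exact subset_toMeasurable _ _ ⟨y, hn, hxy.symm⟩

theorem Equivalent.symm (h : A.Equivalent B) : B.Equivalent A :=
  ⟨measurable_swap h.1 |> fun h' => by
      convert h' using 1
      ext z
      exact eq_comm,
    fun N => (h.2 N).symm⟩

/-- Equivalent desingularizations are related by Borel maps which cover the identity almost
everywhere. -/
theorem Equivalent.exists_map (h : A.Equivalent B) : ∃ φ : A.X → B.X, Measurable φ ∧
    (∀ x y, A.Rel x y → B.Rel (φ x) (φ y)) ∧ ∀ᵐ x ∂A.μ, B.proj (φ x) = A.proj x := by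
  classical
  have : Nonempty B.X := nonempty_of_isProbabilityMeasure B.μ
  have hne : ∀ᵐ x ∂A.μ, ∃ y, (x, y) ∈ {z : A.X × B.X | A.proj z.1 = B.proj z.2} := by
    have h0 : A.μ (A.proj ⁻¹' (Set.range B.proj)ᶜ) = 0 := by
      rw [h.2, Set.preimage_compl, Set.preimage_range, Set.compl_univ, measure_empty]
    filter_upwards [compl_mem_ae_iff.2 h0] with x hx
    obtain ⟨y, hy⟩ : A.proj x ∈ Set.range B.proj := by
      by_contra hcon
      exact hx hcon
    exact ⟨y, hy.symm⟩
  obtain ⟨f, hf, hfZ⟩ := exists_measurable_ae_selection A.μ h.1 hne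
  -- Invariance of `G` makes the map preserve the relation everywhere, although it is constant off
  -- `G`.
  obtain ⟨G, hG, hGae, hGf, hGinv⟩ := A.exists_invariant_conull hfZ
  refine ⟨fun x => if x ∈ G then f x else Classical.arbitrary B.X,
    Measurable.ite hG hf measurable_const, fun x y hxy => ?_, ?_⟩
  · by_cases hx : x ∈ G
    · have hy := hGinv x y hxy hx
      simp only [hx, hy, if_true]
      exact ((hGf x hx).symm.trans hxy).trans (hGf y hy)
    · have hy : y ∉ G := fun hy => hx (hGinv y x hxy.symm' hy)
      simp only [hx, hy, if_false]
      exact B.rel_refl _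
  · filter_upwards [hGae] with x hx
    simp only [hx, if_true]
    exact (hGf x hx).symm

/-- A null set of B is enlarged to its saturation, which comes from a null subset of Q. Such a
subset is also null for A, and φ covers the identity of Q. -/
theorem Equivalent.ae_comp (h : A.Equivalent B) {φ : A.X → B.X}
    (hφ : ∀ᵐ x ∂A.μ, B.proj (φ x) = A.proj x) {P : B.X → Prop} (hP : ∀ᵐ y ∂B.μ, P y) :
    ∀ᵐ x ∂A.μ, P (φ x) := by
  have h0 := (h.2 _).2 (B.measure_saturation_eq_zero hP)
  filter_upwards [hφ, compl_mem_ae_iff.2 h0] with x hx hxN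
  by_contra hcon
  exact hxN ⟨φ x, hcon, hx⟩

/-- The pullback of a representation under a Borel map which preserves the relations. -/
def UnitaryRep.comap {H : HilbertField B.X} (π : B.UnitaryRep H) {φ : A.X → B.X}
    (hφ : Measurable φ) (hr : ∀ x y, A.Rel x y → B.Rel (φ x) (φ y)) :
    A.UnitaryRep (H.comap φ hφ) where
  op x y h := π.op (φ x) (φ y) (hr x y h)
  op_self x v := π.op_self (φ x) v
  op_comp x y z hxy hyz v := π.op_comp (φ x) (φ y) (φ z) (hr x y hxy) (hr y z hyz) v
  measurable_coeff ξ η hξ hη := by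
    have h1 : Measurable fun z : {z : A.X × A.X // A.Rel z.1 z.2} => z.1.1 :=
      measurable_fst.comp measurable_subtype_coe
    have h2 : Measurable fun z : {z : A.X × A.X // A.Rel z.1 z.2} => z.1.2 :=
      measurable_snd.comp measurable_subtype_coe
    exact π.measurable_coeff_comap (hφ.comp h1) (hφ.comp h2) (fun z => hr _ _ z.2)
      (ζ := fun z => η z.1.1) (θ := fun z => ξ z.1.2)
      (fun n => (hη n).comp h1) (fun n => (hξ n).comp h2)

theorem UnitaryRep.AlmostHasInvariantFields.comap (h : A.Equivalent B) {H : HilbertField B.X}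
    {π : B.UnitaryRep H} (hπ : π.AlmostHasInvariantFields) {φ : A.X → B.X}
    (hφ : Measurable φ) (hr : ∀ x y, A.Rel x y → B.Rel (φ x) (φ y))
    (hφp : ∀ᵐ x ∂A.μ, B.proj (φ x) = A.proj x) :
    (π.comap hφ hr).AlmostHasInvariantFields := by
  obtain ⟨ξ, K, ε, hξ, hξ1, hK, hKr, hKm, hKe, hε, hKξ⟩ := hπ
  refine ⟨fun n x => ξ n (φ x), fun n => {z | A.Rel z.1 z.2 ∧ (φ z.1, φ z.2) ∈ K n}, ε,
    fun n => HilbertField.measurableSection_comap H hφ (hξ n), fun n => h.ae_comp hφp (hξ1 n),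
    fun n => ?_, fun n z hz => hz.1, fun m n hmn z hz => ⟨hz.1, hKm hmn hz.2⟩, ?_, hε, fun n => ?_⟩
  · exact A.measurableSet_rel.inter
      ((hφ.comp measurable_fst).prodMk (hφ.comp measurable_snd) (hK n))
  · filter_upwards [h.ae_comp hφp hKe] with x hx y hxy
    obtain ⟨n, hn⟩ := hx (φ y) (hr x y hxy)
    exact ⟨n, hxy, hn⟩
  · filter_upwards [h.ae_comp hφp (hKξ n)] with x hx y hxy hxyK
    exact hx (φ y) (hr x y hxy) hxyK.2

/-- With φ : A → B and ψ : B → A covering the identity, property T of A gives an invariant field ξ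
of the pullback by φ. The vector ξ_{ψx} lies in the fibre at φ(ψx), which is almost surely
equivalent to x, and π(x, φ(ψx)) brings it back to the fibre at x. -/
theorem RelPropertyT.of_equivalent (h : A.Equivalent B) (hA : A.RelPropertyT) :
    B.RelPropertyT := by
  classical
  intro H π hπ
  obtain ⟨φ, hφ, hφr, hφp⟩ := h.exists_map
  obtain ⟨ψ, hψ, hψr, hψp⟩ := h.symm.exists_map
  obtain ⟨ξ, hξ, hξ1, hξinv⟩ := hA _ _ (hπ.comap h hφ hφr hφp)
  have hα : Measurable fun x => φ (ψ x) := hφ.comp hψ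
  have hS : MeasurableSet {x | B.Rel x (φ (ψ x))} :=
    (measurable_id.prodMk hα) B.measurableSet_rel
  have hSae : ∀ᵐ x ∂B.μ, B.Rel x (φ (ψ x)) := by
    filter_upwards [hψp, h.symm.ae_comp hψp hφp] with x h1 h2
    exact h1.symm.trans h2.symm
  obtain ⟨ζ, hζ, hζ1, hζinv⟩ : ∃ ζ : ∀ x, H.fiber (φ (ψ x)),
      (∀ n, Measurable fun x => inner ℂ (H.fundamental n (φ (ψ x))) (ζ x)) ∧
      (∀ᵐ x ∂B.μ, ‖ζ x‖ = 1) ∧ ∀ᵐ x ∂B.μ, ∀ y (hxy : B.Rel x y),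
        π.op (φ (ψ x)) (φ (ψ y)) (hφr _ _ (hψr _ _ hxy)) (ζ y) = ζ x := by
    refine ⟨fun x => ξ (ψ x), fun n => (hξ n).comp hψ, h.symm.ae_comp hψp hξ1, ?_⟩
    filter_upwards [h.symm.ae_comp hψp hξinv] with x hinv y hxy
    exact hinv (ψ y) (hψr _ _ hxy)
  refine ⟨fun x => if hx : B.Rel x (φ (ψ x)) then π.op x (φ (ψ x)) hx (ζ x) else 0,
    fun n => ?_, ?_, ?_⟩
  · have hval : Measurable fun x : {x // B.Rel x (φ (ψ x))} =>
        inner ℂ (H.fundamental n x.1) (π.op x.1 (φ (ψ x.1)) x.2 (ζ x.1)) :=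
      π.measurable_coeff_comap measurable_subtype_coe (hα.comp measurable_subtype_coe)
        (fun x => x.2) (ζ := fun x => H.fundamental n x.1) (θ := fun x => ζ x.1)
        (HilbertField.measurableSection_comap H measurable_subtype_coe
          (HilbertField.MeasurableSection.fundamental n))
        (fun m => (hζ m).comp measurable_subtype_coe)
    have := Measurable.dite (s := {x | B.Rel x (φ (ψ x))})
      (f := fun x : {x // B.Rel x (φ (ψ x))} =>
        inner ℂ (H.fundamental n x.1) (π.op x.1 (φ (ψ x.1)) x.2 (ζ x.1)))
      (g := fun _ => 0) hval measurable_const hS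
    convert this using 2 with x
    beta_reduce
    by_cases hx : B.Rel x (φ (ψ x))
    · have hx' : x ∈ {x | B.Rel x (φ (ψ x))} := hx
      rw [dif_pos hx, dif_pos hx']
    · have hx' : x ∉ {x | B.Rel x (φ (ψ x))} := hx
      rw [dif_neg hx, dif_neg hx', inner_zero_right]
  · filter_upwards [hSae, hζ1] with x hx h1
    rw [dif_pos hx, LinearIsometryEquiv.norm_map]
    exact h1
  · filter_upwards [B.ae_forall_rel hSae, hζinv] with x hx hinv y hxy
    rw [dif_pos (hx x (B.rel_refl x)), dif_pos (hx y hxy), ← π.op_comp, ← hinv y hxy,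
      ← π.op_comp]

end DiscreteDesingularization

/-! ### The spectral gap inequality of a finite graph -/

section GraphGap

open scoped ComplexConjugate

variable {V : Type*} [Fintype V] (L : SimpleGraph V) [DecidableRel L.Adj]

theorem graphDiffusion_eq (f : V → ℂ) (y : V) :
    graphDiffusion L f y = (L.degree y : ℂ)⁻¹ * ∑ z, if L.Adj y z then f z else 0 := by
  rw [graphDiffusion, Set.ncard_eq_toFinset_card', ← Finset.sum_filter, ← finsum_mem_finset_eq_sum]
  congr 1
  refine finsum_mem_congr ?_ fun _ _ => rfl
  ext z
  simp

/-- The Dirichlet energy of a function on a graph, each edge being counted once. -/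
noncomputable def graphEnergy {E : Type*} [NormedAddCommGroup E] (f : V → E) : ℝ :=
  2⁻¹ * ∑ y, ∑ z, if L.Adj y z then ‖f y - f z‖ ^ 2 else 0

theorem graphEnergy_nonneg {E : Type*} [NormedAddCommGroup E] (f : V → E) :
    0 ≤ graphEnergy L f := by
  unfold graphEnergy
  refine mul_nonneg (by norm_num) (Finset.sum_nonneg fun y _ => Finset.sum_nonneg fun z _ => ?_)
  split_ifs <;> positivity

/-- Weighting by the degree cancels the normalization of the random walk. The two orientations of an
edge then add up to |f y - f z|². -/
theorem sum_degree_mul_laplacian (hd : ∀ y, L.degree y ≠ 0) (f : V → ℂ) :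
    ∑ y, (L.degree y : ℂ) * (conj (f y) * (f y - graphDiffusion L f y)) = graphEnergy L f := by
  have h1 : ∀ y, (L.degree y : ℂ) * (conj (f y) * (f y - graphDiffusion L f y)) =
      ∑ z, if L.Adj y z then conj (f y) * (f y - f z) else 0 := by
    intro y
    have hy : (L.degree y : ℂ) ≠ 0 := by exact_mod_cast hd y
    rw [graphDiffusion_eq]
    have h2 : (L.degree y : ℂ) = ∑ z, if L.Adj y z then 1 else 0 := by
      rw [Finset.sum_boole, ← SimpleGraph.card_neighborFinset_eq_degree,
        SimpleGraph.neighborFinset_eq_filter]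
    calc _ = (L.degree y : ℂ) * (conj (f y) * f y) -
          conj (f y) * ∑ z, (if L.Adj y z then f z else 0) := by field_simp
      _ = _ := by
        rw [h2, Finset.sum_mul, Finset.mul_sum, ← Finset.sum_sub_distrib]
        refine Finset.sum_congr rfl fun z _ => ?_
        split_ifs <;> ring
  simp only [h1, graphEnergy]
  have hsymm : ∑ y, ∑ z, (if L.Adj y z then conj (f y) * (f y - f z) else 0) =
      ∑ y, ∑ z, (if L.Adj y z then conj (f z) * (f z - f y) else 0) := by
    rw [Finset.sum_comm]
    simp only [L.adj_comm]
  have h3 : ((∑ y, ∑ z, if L.Adj y z then ‖f y - f z‖ ^ 2 else 0 : ℝ) : ℂ) =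
      ∑ y, ∑ z, (if L.Adj y z then conj (f y) * (f y - f z) else 0) +
      ∑ y, ∑ z, (if L.Adj y z then conj (f z) * (f z - f y) else 0) := by
    push_cast
    rw [← Finset.sum_add_distrib]
    refine Finset.sum_congr rfl fun y _ => ?_
    rw [← Finset.sum_add_distrib]
    refine Finset.sum_congr rfl fun z _ => ?_
    split_ifs
    · push_cast
      rw [← Complex.conj_mul', map_sub]
      ring
    · simp
  push_cast at h3 ⊢
  rw [h3, ← hsymm]
  ring

theorem eq_of_graphEnergy_eq_zero {E : Type*} [NormedAddCommGroup E] (hL : L.Connected)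
    {f : V → E} (hf : graphEnergy L f = 0) (y z : V) : f y = f z := by
  have hnn : ∀ y z, 0 ≤ if L.Adj y z then ‖f y - f z‖ ^ 2 else 0 := fun y z => by
    split_ifs <;> positivity
  have h0 : ∀ y z, L.Adj y z → f y = f z := by
    intro y z hyz
    have h1 : ∑ y, ∑ z, (if L.Adj y z then ‖f y - f z‖ ^ 2 else 0) = 0 := by
      unfold graphEnergy at hf
      linarith
    have h2 := (Finset.sum_eq_zero_iff_of_nonneg
      fun y _ => Finset.sum_nonneg fun z _ => hnn y z).1 h1 y (Finset.mem_univ y)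
    have h3 := (Finset.sum_eq_zero_iff_of_nonneg fun z _ => hnn y z).1 h2 z (Finset.mem_univ z)
    rw [if_pos hyz] at h3
    exact sub_eq_zero.1 (norm_eq_zero.1 (pow_eq_zero_iff two_ne_zero |>.1 h3))
  obtain ⟨p⟩ := hL.preconnected y z
  induction p with
  | nil => rfl
  | cons h _ ih => exact (h0 _ _ h).trans ih

theorem energy_eigenfunction (hd : ∀ y, L.degree y ≠ 0) {f : V → ℂ} {θ : ℝ}
    (hf : ∀ y, f y - graphDiffusion L f y = θ * f y) :
    graphEnergy L f = θ * ∑ y, L.degree y * ‖f y‖ ^ 2 := by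
  have h := sum_degree_mul_laplacian L hd f
  have : ∑ y, (L.degree y : ℂ) * (conj (f y) * (f y - graphDiffusion L f y)) =
      ((θ * ∑ y, L.degree y * ‖f y‖ ^ 2 : ℝ) : ℂ) := by
    push_cast
    rw [Finset.mul_sum]
    refine Finset.sum_congr rfl fun y _ => ?_
    rw [hf, ← Complex.conj_mul']
    ring
  exact_mod_cast h.symm.trans this

/-- The energy identity makes all eigenvalues nonnegative, so the real infimum is over a set bounded
below. -/
theorem lambdaOne_le (hd : ∀ y, L.degree y ≠ 0) {θ : ℝ} (hθ : θ ∈ graphSpectrum L) (h0 : θ ≠ 0) :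
    lambdaOne L ≤ θ := by
  refine csInf_le ⟨0, ?_⟩ ⟨hθ, h0⟩
  rintro θ ⟨⟨f, hf, hfθ⟩, -⟩
  have h1 := energy_eigenfunction L hd hfθ
  have h2 : 0 < ∑ y, (L.degree y : ℝ) * ‖f y‖ ^ 2 := by
    obtain ⟨y, hy⟩ := Function.ne_iff.1 hf
    refine Finset.sum_pos' (fun _ _ => by positivity) ⟨y, Finset.mem_univ y, ?_⟩
    have := Nat.pos_of_ne_zero (hd y)
    have := norm_pos_iff.2 hy
    positivity
  by_contra! hneg
  have := graphEnergy_nonneg L f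
  nlinarith

/-- The random walk Laplacian is symmetric only for the degree weights. Conjugation by the square
root of the degree gives the Hermitian matrix S, whose eigenvectors, rescaled by s, are
eigenfunctions of the Laplacian. Expanding the rescaled g in an eigenbasis leaves only eigenvalues
at least `lam`. -/
theorem scalar_gap (hL : L.Connected) (hd : ∀ y, L.degree y ≠ 0) {lam : ℝ}
    (hlam : lam ≤ lambdaOne L) {g : V → ℂ} (hg : ∑ y, (L.degree y : ℂ) * g y = 0) :
    lam * ∑ y, L.degree y * ‖g y‖ ^ 2 ≤ graphEnergy L g := by
  classical
  let s : V → ℝ := fun y => (√(L.degree y))⁻¹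
  have hdpos : ∀ y, (0 : ℝ) < L.degree y := fun y => by exact_mod_cast Nat.pos_of_ne_zero (hd y)
  have hs : ∀ y, (L.degree y : ℂ) * s y = (s y : ℂ)⁻¹ := by
    intro y
    have h : (L.degree y : ℝ) * s y = (s y)⁻¹ := by
      simp only [s, inv_inv]
      rw [← div_eq_mul_inv, Real.div_sqrt]
    exact_mod_cast h
  have hs0 : ∀ y, (s y : ℂ) ≠ 0 := fun y => by
    have : s y ≠ 0 := inv_ne_zero (Real.sqrt_ne_zero'.2 (hdpos y))
    exact_mod_cast this
  let S : Matrix V V ℂ := Matrix.of fun y z =>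
    (if y = z then 1 else 0) - s y * s z * (if L.Adj y z then 1 else 0)
  have hS : S.IsHermitian := by
    ext y z
    simp only [S, Matrix.conjTranspose_apply, Matrix.of_apply, star_sub, star_mul',
      RCLike.star_def, Complex.conj_ofReal, L.adj_comm, eq_comm (a := y)]
    split_ifs <;> simp <;> ring
  let T := Matrix.toEuclideanLin S
  have hT : T.IsSymmetric := Matrix.isSymmetric_toEuclideanLin_iff.2 hS
  have hTapply : ∀ (u : EuclideanSpace ℂ V) y, T u y =
      u y - s y * ∑ z, if L.Adj y z then s z * u z else 0 := by
    intro u y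
    change (S.mulVec u.ofLp) y = _
    simp only [Matrix.mulVec, dotProduct, S, Matrix.of_apply, sub_mul, Finset.sum_sub_distrib,
      ite_mul, one_mul, zero_mul, Finset.sum_ite_eq, Finset.mem_univ, if_true]
    rw [Finset.mul_sum]
    congr 1
    refine Finset.sum_congr rfl fun z _ => ?_
    split_ifs <;> ring
  have hlap : ∀ (u : EuclideanSpace ℂ V) y,
      (s y * u y) - graphDiffusion L (fun z => s z * u z) y = s y * T u y := by
    intro u y
    rw [graphDiffusion_eq, hTapply]
    have hdy : (L.degree y : ℂ)⁻¹ = s y * s y := by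
      have h := hs y
      have h' := hs0 y
      field_simp at h ⊢
      rw [div_eq_iff (by exact_mod_cast hd y)]
      linear_combination -h
    rw [hdy]
    ring
  let b := hT.eigenvectorBasis rfl
  let θ := hT.eigenvalues rfl
  have hb : ∀ k, T (b k) = (θ k : ℂ) • b k := fun k => hT.apply_eigenvectorBasis rfl k
  have hfk : ∀ k y, (s y * b k y) - graphDiffusion L (fun z => s z * b k z) y =
      (θ k : ℂ) * (s y * b k y) := by
    intro k y
    rw [hlap, hb]
    simp only [PiLp.smul_apply, smul_eq_mul]
    ring
  let u : EuclideanSpace ℂ V := WithLp.toLp 2 fun y => (s y : ℂ)⁻¹ * g y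
  have hug : (fun y => (s y : ℂ) * u y) = g := by
    ext y
    change (s y : ℂ) * ((s y : ℂ)⁻¹ * g y) = g y
    rw [mul_inv_cancel_left₀ (hs0 y)]
  -- On a connected graph an eigenfunction for 0 has zero energy and is constant, so the hypothesis
  -- that g has weighted mean zero kills these components.
  have horth : ∀ k, θ k = 0 → inner ℂ (b k) u = 0 := by
    intro k hk
    have hE := energy_eigenfunction L hd (hfk k)
    rw [hk, zero_mul] at hE
    obtain ⟨y0⟩ := hL.nonempty
    have hc : ∀ y, b k y = (s y : ℂ)⁻¹ * (s y0 * b k y0) := fun y => by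
      rw [← eq_of_graphEnergy_eq_zero L hL hE y y0, inv_mul_cancel_left₀ (hs0 y)]
    rw [PiLp.inner_apply]
    have : ∀ y, inner ℂ (b k y) (u y) =
        conj ((s y0 : ℂ) * b k y0) * ((L.degree y : ℂ) * g y) := by
      intro y
      have hdy : (L.degree y : ℂ) = (s y : ℂ)⁻¹ * (s y : ℂ)⁻¹ := by
        rw [← hs y, mul_assoc, hs y, mul_inv_cancel₀ (hs0 y), mul_one]
      rw [RCLike.inner_apply, hc y, hdy]
      change ((s y : ℂ)⁻¹ * g y) * conj _ = _
      rw [map_mul, map_inv₀, Complex.conj_ofReal]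
      ring
    simp only [this]
    rw [← Finset.mul_sum, hg, mul_zero]
  have hθ : ∀ k, θ k ≠ 0 → lam ≤ θ k := by
    intro k hk
    refine hlam.trans (lambdaOne_le L hd ⟨fun y => s y * b k y, ?_, hfk k⟩ hk)
    intro h0
    have : b k = 0 := by
      ext y
      exact (mul_eq_zero.1 (congrFun h0 y)).resolve_left (hs0 y)
    exact b.orthonormal.ne_zero k this
  have hnorm : ∑ y, (L.degree y : ℝ) * ‖g y‖ ^ 2 = ‖u‖ ^ 2 := by
    rw [EuclideanSpace.norm_sq_eq]
    refine Finset.sum_congr rfl fun y _ => ?_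
    change _ = ‖(s y : ℂ)⁻¹ * g y‖ ^ 2
    rw [norm_mul, mul_pow, norm_inv, Complex.norm_real]
    simp only [s, norm_inv, inv_inv, Real.norm_eq_abs, sq_abs, Real.sq_sqrt (hdpos y).le]
  have hen : (graphEnergy L g : ℂ) = inner ℂ u (T u) := by
    rw [← sum_degree_mul_laplacian L hd, PiLp.inner_apply]
    refine Finset.sum_congr rfl fun y _ => ?_
    have h := hlap u y
    rw [hug, show (s y : ℂ) * u y = g y from congrFun hug y] at h
    rw [h, RCLike.inner_apply]
    change _ = T u y * conj ((s y : ℂ)⁻¹ * g y)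
    rw [map_mul, map_inv₀, Complex.conj_ofReal, ← hs]
    ring
  have hen' : graphEnergy L g = ∑ k, θ k * ‖inner ℂ (b k) u‖ ^ 2 := by
    have : inner ℂ u (T u) = ((∑ k, θ k * ‖inner ℂ (b k) u‖ ^ 2 : ℝ) : ℂ) := by
      rw [← b.sum_inner_mul_inner]
      push_cast
      refine Finset.sum_congr rfl fun k _ => ?_
      rw [← hT, hb, inner_smul_left, Complex.conj_ofReal, ← Complex.conj_mul', inner_conj_symm]
      ring
    exact_mod_cast hen.trans this
  rw [hen', hnorm, ← b.sum_sq_norm_inner_right, Finset.mul_sum]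
  refine Finset.sum_le_sum fun k _ => ?_
  by_cases hk : θ k = 0
  · simp [horth k hk]
  · exact mul_le_mul_of_nonneg_right (hθ k hk) (by positivity)

variable {E : Type*} [NormedAddCommGroup E] [InnerProductSpace ℂ E]

/-- Both sides are sums over the coordinates in an orthonormal basis of the finite dimensional span
of the values. -/
theorem vector_gap (hL : L.Connected) (hd : ∀ y, L.degree y ≠ 0) {lam : ℝ}
    (hlam : lam ≤ lambdaOne L) {g : V → E} (hg : ∑ y, (L.degree y : ℂ) • g y = 0) :
    lam * ∑ y, L.degree y * ‖g y‖ ^ 2 ≤ graphEnergy L g := by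
  let W := Submodule.span ℂ (Set.range g)
  have : FiniteDimensional ℂ W := FiniteDimensional.span_of_finite ℂ (Set.finite_range g)
  let b := stdOrthonormalBasis ℂ W
  let F : V → W := fun y => ⟨g y, Submodule.subset_span ⟨y, rfl⟩⟩
  have hF : ∑ y, (L.degree y : ℂ) • F y = 0 := by
    apply Subtype.ext
    rw [Submodule.coe_sum]
    exact hg
  have hnorm : ∀ v : W, ‖(v : E)‖ ^ 2 = ∑ k, ‖inner ℂ (b k) v‖ ^ 2 := fun v => by
    rw [b.sum_sq_norm_inner_right]; rfl
  have hk : ∀ k, lam * ∑ y, L.degree y * ‖inner ℂ (b k) (F y)‖ ^ 2 ≤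
      graphEnergy L fun y => inner ℂ (b k) (F y) := fun k => by
    refine scalar_gap L hL hd hlam ?_
    simp only [← inner_smul_right, ← inner_sum, hF, inner_zero_right]
  have h1 : ∑ y, (L.degree y : ℝ) * ‖g y‖ ^ 2 =
      ∑ k, ∑ y, (L.degree y : ℝ) * ‖inner ℂ (b k) (F y)‖ ^ 2 := by
    rw [Finset.sum_comm]
    refine Finset.sum_congr rfl fun y _ => ?_
    rw [← Finset.mul_sum, ← hnorm]
  have h2 : graphEnergy L g = ∑ k, graphEnergy L fun y => inner ℂ (b k) (F y) := by
    have h3 : ∀ y z, (if L.Adj y z then ‖g y - g z‖ ^ 2 else 0) =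
        ∑ k, if L.Adj y z then ‖inner ℂ (b k) (F y) - inner ℂ (b k) (F z)‖ ^ 2 else 0 := by
      intro y z
      split_ifs
      · simp only [← inner_sub_right]
        rw [← hnorm]
        rfl
      · simp
    simp only [graphEnergy, h3]
    rw [← Finset.mul_sum]
    congr 1
    symm
    rw [Finset.sum_comm]
    exact Finset.sum_congr rfl fun y _ => Finset.sum_comm
  rw [h1, h2, Finset.mul_sum]
  exact Finset.sum_le_sum fun k _ => hk k

/-- The spectral gap inequality of a connected graph. The weight of the vertex of a one point graph
is set to `1`. -/
theorem weighted_gap (hL : L.Connected) {lam : ℝ} (hlam : lam ≤ lambdaOne L) {f : V → E} {a : E}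
    (ha : ∑ y, (max (L.degree y : ℝ) 1) • (f y - a) = 0) :
    lam * ∑ y, max (L.degree y : ℝ) 1 * ‖f y - a‖ ^ 2 ≤ graphEnergy L f := by
  cases subsingleton_or_nontrivial V with
  | inl h =>
    obtain ⟨y0⟩ := hL.nonempty
    have hfa : f y0 - a = 0 := by
      rw [Fintype.sum_subsingleton (fun y => max (L.degree y : ℝ) 1 • (f y - a)) y0,
        smul_eq_zero] at ha
      refine ha.resolve_left (ne_of_gt (lt_of_lt_of_le one_pos (le_max_right _ _)))
    rw [Fintype.sum_subsingleton (fun y => max (L.degree y : ℝ) 1 * ‖f y - a‖ ^ 2) y0, hfa]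
    simpa using graphEnergy_nonneg L f
  | inr h =>
    have hd : ∀ y, L.degree y ≠ 0 := fun y => (hL.preconnected.degree_pos_of_nontrivial y).ne'
    have hmax : ∀ y, max (L.degree y : ℝ) 1 = L.degree y := fun y =>
      max_eq_left (by exact_mod_cast Nat.one_le_iff_ne_zero.2 (hd y))
    simp only [hmax] at ha ⊢
    have := vector_gap L hL hd hlam (g := fun y => f y - a) (by
      rw [← ha]
      refine Finset.sum_congr rfl fun y _ => ?_
      rw [← Complex.coe_smul]
      simp)
    simpa only [graphEnergy, sub_sub_sub_cancel_right] using this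

end GraphGap

/-! ### Transport along a representation -/

namespace DiscreteDesingularization

variable {Q : Type u} {D : DiscreteDesingularization Q} {H : HilbertField D.X}

open Classical in
/-- The operator of a representation, extended by `0` to the pairs outside the relation. -/
noncomputable def UnitaryRep.act (π : D.UnitaryRep H) (x y : D.X) : H.fiber y →ₗ[ℂ] H.fiber x :=
  if h : D.Rel x y then (π.op x y h).toLinearEquiv.toLinearMap else 0

namespace UnitaryRep

variable (π : D.UnitaryRep H) {x y z : D.X}

theorem act_of_rel (h : D.Rel x y) (v : H.fiber y) : π.act x y v = π.op x y h v := by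
  rw [act, dif_pos h]
  rfl

theorem norm_act (h : D.Rel x y) (v : H.fiber y) : ‖π.act x y v‖ = ‖v‖ := by
  rw [π.act_of_rel h, LinearIsometryEquiv.norm_map]

theorem inner_act (h : D.Rel x y) (v w : H.fiber y) :
    inner ℂ (π.act x y v) (π.act x y w) = inner ℂ v w := by
  rw [π.act_of_rel h, π.act_of_rel h, LinearIsometryEquiv.inner_map_map]

theorem act_act (hxy : D.Rel x y) (hyz : D.Rel y z) (v : H.fiber z) :
    π.act x y (π.act y z v) = π.act x z v := by
  rw [π.act_of_rel hxy, π.act_of_rel hyz, π.act_of_rel (hxy.trans' hyz)]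
  exact (π.op_comp x y z hxy hyz v).symm

theorem act_self (v : H.fiber x) : π.act x x v = v := by
  rw [π.act_of_rel (D.rel_refl x), π.op_self]

theorem measurableSection_act {ξ : ∀ x, H.fiber x} (hξ : H.MeasurableSection ξ) :
    (H.comap (Prod.fst : D.X × D.X → D.X) measurable_fst).MeasurableSection
      fun p => π.act p.1 p.2 (ξ p.2) := by
  classical
  intro n
  have h := Measurable.dite (s := {z : D.X × D.X | D.Rel z.1 z.2})
    (f := fun z : {z : D.X × D.X // D.Rel z.1 z.2} =>
      inner ℂ (H.fundamental n z.1.1) (π.op z.1.1 z.1.2 z.2 (ξ z.1.2)))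
    (g := fun _ => 0)
    (π.measurable_coeff _ _ hξ (HilbertField.MeasurableSection.fundamental n))
    measurable_const D.measurableSet_rel
  convert h using 2 with z
  by_cases hz : D.Rel z.1 z.2
  · have hz' : z ∈ {z : D.X × D.X | D.Rel z.1 z.2} := hz
    rw [dif_pos hz']
    exact congrArg (inner ℂ (H.fundamental n z.1)) (π.act_of_rel hz _)
  · have hz' : z ∉ {z : D.X × D.X | D.Rel z.1 z.2} := hz
    rw [dif_neg hz']
    have h0 : π.act z.1 z.2 = 0 := dif_neg hz
    change inner ℂ (H.fundamental n z.1) (π.act z.1 z.2 (ξ z.2)) = 0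
    rw [h0, LinearMap.zero_apply, inner_zero_right]

/-- The coboundary of a section. -/
noncomputable def coboundary (ξ : ∀ x, H.fiber x) (x y : D.X) : H.fiber x :=
  π.act x y (ξ y) - ξ x

theorem measurableSection_coboundary {ξ : ∀ x, H.fiber x} (hξ : H.MeasurableSection ξ) :
    (H.comap (Prod.fst : D.X × D.X → D.X) measurable_fst).MeasurableSection
      fun p => π.coboundary ξ p.1 p.2 :=
  (π.measurableSection_act hξ).sub (HilbertField.measurableSection_comap H measurable_fst hξ)

theorem coboundary_symm (ξ : ∀ x, H.fiber x) (h : D.Rel x y) :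
    π.coboundary ξ y x = -π.act y x (π.coboundary ξ x y) := by
  simp only [coboundary, map_sub, π.act_act h.symm' h, π.act_self, neg_sub]

/-- Cocycle identity c(x,z) - c(x,y) = π(x,y)c(y,z): the link energy of c(x,·) is the energy of the
edges opposite to x. -/
theorem norm_coboundary_sub (ξ : ∀ x, H.fiber x) (hxy : D.Rel x y) (hyz : D.Rel y z) :
    ‖π.coboundary ξ x y - π.coboundary ξ x z‖ = ‖π.coboundary ξ y z‖ := by
  rw [← π.norm_act hxy (π.coboundary ξ y z)]
  simp only [coboundary, map_sub, π.act_act hxy hyz]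
  rw [sub_sub_sub_cancel_right, norm_sub_rev]

theorem norm_coboundary_le {ξ : ∀ x, H.fiber x} (hξ : ∀ x, ‖ξ x‖ ≤ 1) (h : D.Rel x y) :
    ‖π.coboundary ξ x y‖ ≤ 2 := by
  refine (norm_sub_le _ _).trans ?_
  rw [π.norm_act h]
  linarith [hξ x, hξ y]

end UnitaryRep

/-! ### Graphings with spectral gap in the links -/

open Classical in
/-- A bounded degree graphing together with triangles whose links satisfy a spectral gap inequality,
and with a Radon-Nikodym cocycle which is bounded on the edges. -/
structure GappedGraphing (D : DiscreteDesingularization Q) where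
  nb : D.X → Finset D.X
  tri : D.X → D.X → D.X → Prop
  N : ℕ
  δ : D.X → D.X → ℝ
  bound : ℝ
  lam : ℝ
  measurableSet_nb : MeasurableSet {p : D.X × D.X | p.2 ∈ nb p.1}
  measurableSet_tri : MeasurableSet {p : D.X × D.X × D.X | tri p.1 p.2.1 p.2.2}
  measurable_δ : Measurable (Function.uncurry δ)
  card_le : ∀ x, (nb x).card ≤ N
  rel : ∀ x, ∀ y ∈ nb x, D.Rel x y
  nb_symm : ∀ x, ∀ y ∈ nb x, x ∈ nb y
  tri_mem : ∀ x y z, tri x y z → y ∈ nb x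
  tri_swap : ∀ x y z, tri x y z → tri x z y
  tri_rot : ∀ x y z, tri x y z → tri y x z
  one_le_bound : 1 ≤ bound
  le_δ : ∀ x, ∀ y ∈ nb x, bound⁻¹ ≤ δ x y
  δ_le : ∀ x, ∀ y ∈ nb x, δ x y ≤ bound
  lt_lam : bound ^ 3 / 2 < lam
  gap : ∀ (x : D.X) (E : Type u) [NormedAddCommGroup E] [InnerProductSpace ℂ E]
    (f : D.X → E) (a : E),
    ∑ y ∈ nb x, max (((nb x).filter (tri x y)).card : ℝ) 1 • (f y - a) = 0 →
    lam * ∑ y ∈ nb x, max (((nb x).filter (tri x y)).card : ℝ) 1 * ‖f y - a‖ ^ 2 ≤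
      2⁻¹ * ∑ y ∈ nb x, ∑ z ∈ nb x, if tri x y z then ‖f y - f z‖ ^ 2 else 0
  transport : ∀ F : D.X → D.X → ℝ≥0∞, Measurable (Function.uncurry F) →
    ∫⁻ x, ∑ y ∈ nb x, F x y ∂D.μ = ∫⁻ x, ∑ y ∈ nb x, F y x * ENNReal.ofReal (δ y x) ∂D.μ

namespace GappedGraphing

variable (G : D.GappedGraphing)

open Classical in
/-- The weight of an edge: the number of its triangles, or `1` if there are none. -/
noncomputable def w (x y : D.X) : ℝ := max (((G.nb x).filter (G.tri x y)).card : ℝ) 1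

variable {G} {x y z : D.X}

theorem one_le_w : 1 ≤ G.w x y := le_max_right _ _

theorem w_pos : 0 < G.w x y := one_pos.trans_le one_le_w

theorem w_le : G.w x y ≤ G.N + 1 := by
  classical
  refine max_le ?_ (by simp)
  have h : (((G.nb x).filter (G.tri x y)).card : ℝ) ≤ G.N := by
    exact_mod_cast (Finset.card_filter_le _ _).trans (G.card_le x)
  linarith

theorem bound_pos : 0 < G.bound := one_pos.trans_le G.one_le_bound

theorem δ_nonneg (h : y ∈ G.nb x) : 0 ≤ G.δ x y :=
  (inv_pos.2 bound_pos).le.trans (G.le_δ x y h)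

theorem tri_mem' (h : G.tri x y z) : z ∈ G.nb x := G.tri_mem x z y (G.tri_swap x y z h)

/-- The triangles on an edge do not depend on the end from which they are seen; mass transport
therefore leaves the weights unchanged. -/
theorem w_symm : G.w x y = G.w y x := by
  classical
  unfold w
  congr 3
  ext z
  simp only [Finset.mem_filter]
  exact ⟨fun h => ⟨tri_mem' (G.tri_rot x y z h.2), G.tri_rot x y z h.2⟩,
    fun h => ⟨tri_mem' (G.tri_rot y x z h.2), G.tri_rot y x z h.2⟩⟩

theorem measurable_sum_nb {E : Type*} [NormedAddCommGroup E] [NormedSpace ℝ E]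
    [MeasurableSpace E] [BorelSpace E] [SecondCountableTopology E] [CompleteSpace E]
    {F : D.X → D.X → E} (hF : Measurable (Function.uncurry F)) :
    Measurable fun x => ∑ y ∈ G.nb x, F x y :=
  measurable_sum_section G.measurableSet_nb G.card_le hF

theorem measurable_sum_nb_fst {F : D.X → D.X → D.X → ℝ}
    (hF : Measurable fun p : (D.X × D.X) × D.X => F p.1.1 p.1.2 p.2) :
    Measurable (Function.uncurry fun x y => ∑ z ∈ G.nb x, F x y z) :=
  measurable_sum_section (X := D.X × D.X) (nb := fun p => G.nb p.1) (N := G.N)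
    ((measurable_fst.comp measurable_fst).prodMk measurable_snd G.measurableSet_nb)
    (fun p => G.card_le p.1) hF

theorem measurableSet_tri' :
    MeasurableSet {p : (D.X × D.X) × D.X | G.tri p.1.1 p.1.2 p.2} :=
  ((measurable_fst.comp measurable_fst).prodMk
    ((measurable_snd.comp measurable_fst).prodMk measurable_snd)) G.measurableSet_tri

theorem measurable_w : Measurable (Function.uncurry G.w) := by
  classical
  have h : Measurable (Function.uncurry fun x y => ∑ z ∈ G.nb x, if G.tri x y z then (1 : ℝ) else 0) :=
    measurable_sum_nb_fst (Measurable.ite measurableSet_tri' measurable_const measurable_const)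
  convert h.max measurable_const using 2 with p
  simp only [Function.uncurry, w, Finset.sum_boole]
  rfl

/-! ### Integration over edges and mass transport. -/

variable (G) in
/-- The integral over the edges. -/
noncomputable def edgeIntegral (F : D.X → D.X → ℝ) : ℝ := ∫ x, ∑ y ∈ G.nb x, F x y ∂D.μ

/-- Measurable functions of pairs which are bounded on the edges. -/
def EdgeBounded (G : D.GappedGraphing) (F : D.X → D.X → ℝ) : Prop :=
  Measurable (Function.uncurry F) ∧ ∃ B, ∀ x, ∀ y ∈ G.nb x, |F x y| ≤ B

namespace EdgeBounded

variable {F F' : D.X → D.X → ℝ}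

theorem integrable (hF : G.EdgeBounded F) : Integrable (fun x => ∑ y ∈ G.nb x, F x y) D.μ := by
  obtain ⟨hm, B, hB⟩ := hF
  refine Integrable.of_bound (measurable_sum_nb hm).aestronglyMeasurable (G.N * |B|)
    (Eventually.of_forall fun x => ?_)
  refine (norm_sum_le _ _).trans ((Finset.sum_le_card_nsmul _ _ |B| fun y hy =>
    (hB x y hy).trans (le_abs_self B)).trans ?_)
  rw [nsmul_eq_mul]
  exact mul_le_mul_of_nonneg_right (by exact_mod_cast G.card_le x) (abs_nonneg _)

theorem add (hF : G.EdgeBounded F) (hF' : G.EdgeBounded F') :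
    G.EdgeBounded fun x y => F x y + F' x y := by
  obtain ⟨hm, B, hB⟩ := hF
  obtain ⟨hm', B', hB'⟩ := hF'
  exact ⟨hm.add hm', B + B', fun x y hy =>
    (abs_add_le _ _).trans (add_le_add (hB x y hy) (hB' x y hy))⟩

theorem const (a : ℝ) : G.EdgeBounded fun _ _ => a :=
  ⟨measurable_const, |a|, fun _ _ _ => le_rfl⟩

theorem mul (hF : G.EdgeBounded F) (hF' : G.EdgeBounded F') :
    G.EdgeBounded fun x y => F x y * F' x y := by
  obtain ⟨hm, B, hB⟩ := hF
  obtain ⟨hm', B', hB'⟩ := hF'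
  refine ⟨hm.mul hm', B * B', fun x y hy => ?_⟩
  rw [abs_mul]
  exact mul_le_mul (hB x y hy) (hB' x y hy) (abs_nonneg _) ((abs_nonneg _).trans (hB x y hy))

theorem swap (hF : G.EdgeBounded F) : G.EdgeBounded fun x y => F y x := by
  obtain ⟨hm, B, hB⟩ := hF
  exact ⟨hm.comp measurable_swap, B, fun x y hy => hB y x (G.nb_symm x y hy)⟩

theorem weight : G.EdgeBounded G.w :=
  ⟨measurable_w, G.N + 1, fun _ _ _ => by rw [abs_of_pos w_pos]; exact w_le⟩

theorem cocycle : G.EdgeBounded G.δ :=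
  ⟨G.measurable_δ, G.bound, fun x y h => by rw [abs_of_nonneg (δ_nonneg h)]; exact G.δ_le x y h⟩

end EdgeBounded

variable {F F' : D.X → D.X → ℝ}

theorem edgeIntegral_add (hF : G.EdgeBounded F) (hF' : G.EdgeBounded F') :
    G.edgeIntegral (fun x y => F x y + F' x y) = G.edgeIntegral F + G.edgeIntegral F' := by
  simp only [edgeIntegral, Finset.sum_add_distrib]
  exact integral_add hF.integrable hF'.integrable

theorem edgeIntegral_const_mul (a : ℝ) :
    G.edgeIntegral (fun x y => a * F x y) = a * G.edgeIntegral F := by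
  simp only [edgeIntegral, ← Finset.mul_sum]
  exact integral_const_mul _ _

theorem edgeIntegral_mono_sum (hF : G.EdgeBounded F) (hF' : G.EdgeBounded F')
    (h : ∀ x, ∑ y ∈ G.nb x, F x y ≤ ∑ y ∈ G.nb x, F' x y) :
    G.edgeIntegral F ≤ G.edgeIntegral F' :=
  integral_mono hF.integrable hF'.integrable h

theorem edgeIntegral_mono (hF : G.EdgeBounded F) (hF' : G.EdgeBounded F')
    (h : ∀ x, ∀ y ∈ G.nb x, F x y ≤ F' x y) : G.edgeIntegral F ≤ G.edgeIntegral F' :=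
  edgeIntegral_mono_sum hF hF' fun x => Finset.sum_le_sum (h x)

theorem edgeIntegral_congr_sum (h : ∀ x, ∑ y ∈ G.nb x, F x y = ∑ y ∈ G.nb x, F' x y) :
    G.edgeIntegral F = G.edgeIntegral F' := by
  simp only [edgeIntegral, h]

theorem edgeIntegral_congr (h : ∀ x, ∀ y ∈ G.nb x, F x y = F' x y) :
    G.edgeIntegral F = G.edgeIntegral F' :=
  edgeIntegral_congr_sum fun x => Finset.sum_congr rfl (h x)

theorem edgeIntegral_nonneg (h : ∀ x, ∀ y ∈ G.nb x, 0 ≤ F x y) : 0 ≤ G.edgeIntegral F :=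
  integral_nonneg fun x => Finset.sum_nonneg (h x)

theorem edgeIntegral_eq_lintegral (hm : Measurable (Function.uncurry F))
    (h : ∀ x, ∀ y ∈ G.nb x, 0 ≤ F x y) :
    G.edgeIntegral F = (∫⁻ x, ∑ y ∈ G.nb x, ENNReal.ofReal (F x y) ∂D.μ).toReal := by
  rw [edgeIntegral, integral_eq_lintegral_of_nonneg_ae
    (Eventually.of_forall fun x => Finset.sum_nonneg (h x))
    (measurable_sum_nb hm).aestronglyMeasurable]
  congr 2
  funext x
  exact ENNReal.ofReal_sum_of_nonneg (h x)

theorem edgeIntegral_transport_of_nonneg (hF : G.EdgeBounded F)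
    (h : ∀ x, ∀ y ∈ G.nb x, 0 ≤ F x y) :
    G.edgeIntegral F = G.edgeIntegral fun x y => F y x * G.δ y x := by
  rw [edgeIntegral_eq_lintegral hF.1 h, edgeIntegral_eq_lintegral (hF.mul .cocycle).swap.1
    fun x y hy => mul_nonneg (h y x (G.nb_symm x y hy)) (δ_nonneg (G.nb_symm x y hy)),
    G.transport (fun x y => ENNReal.ofReal (F x y)) (ENNReal.measurable_ofReal.comp hF.1)]
  congr 2
  funext x
  exact Finset.sum_congr rfl fun y hy => (ENNReal.ofReal_mul (h y x (G.nb_symm x y hy))).symm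

/-- The transport formula is available for nonnegative functions; adding and then subtracting a
large constant gives the bounded case. -/
theorem edgeIntegral_transport (hF : G.EdgeBounded F) :
    G.edgeIntegral F = G.edgeIntegral fun x y => F y x * G.δ y x := by
  obtain ⟨B, hB⟩ := hF.2
  have h1 := edgeIntegral_transport_of_nonneg (hF.add (.const |B|)) fun x y hy => by
    have := (abs_le.1 ((hB x y hy).trans (le_abs_self B))).1
    linarith
  have h2 := edgeIntegral_transport_of_nonneg (G := G) (.const |B|) fun x y _ => abs_nonneg B
  simp only [add_mul] at h1
  rw [edgeIntegral_add hF (.const _), edgeIntegral_add (hF.mul .cocycle).swap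
    ((EdgeBounded.const |B|).mul .cocycle).swap, h2] at h1
  linarith

end GappedGraphing

end DiscreteDesingularization

/-! ### The energy of a section decreases along the random walk -/

section WeightedMean

variable {ι E : Type*} [NormedAddCommGroup E] [InnerProductSpace ℂ E] {s : Finset ι} {w : ι → ℝ}
  {c : ι → E} {m : E}

theorem re_inner_real_smul_left (a : ℝ) (u v : E) :
    (inner ℂ (a • u) v).re = a * (inner ℂ u v).re := by
  rw [← Complex.coe_smul, inner_smul_left, Complex.conj_ofReal, Complex.re_ofReal_mul]

theorem re_inner_real_smul_right (a : ℝ) (u v : E) :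
    (inner ℂ u (a • v)).re = a * (inner ℂ u v).re := by
  rw [← Complex.coe_smul, inner_smul_right, Complex.re_ofReal_mul]

theorem norm_add_sq_complex (u v : E) :
    ‖u + v‖ ^ 2 = ‖u‖ ^ 2 + 2 * (inner ℂ u v).re + ‖v‖ ^ 2 :=
  @norm_add_sq ℂ _ _ _ _ u v

theorem sum_mul_re_inner_of_mean (h : ∑ y ∈ s, w y • (c y - m) = 0) (v : E) :
    ∑ y ∈ s, w y * (inner ℂ (c y - m) v).re = 0 := by
  calc _ = (inner ℂ (∑ y ∈ s, w y • (c y - m)) v).re := by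
        rw [sum_inner, Complex.re_sum]
        exact Finset.sum_congr rfl fun y _ => (re_inner_real_smul_left _ _ _).symm
    _ = 0 := by rw [h, inner_zero_left, Complex.zero_re]

/-- Pythagoras: deviations from the weighted mean are orthogonal to constants. -/
theorem sum_mul_norm_add_sq_of_mean (h : ∑ y ∈ s, w y • (c y - m) = 0) (v : E) :
    ∑ y ∈ s, w y * ‖c y - m + v‖ ^ 2 =
      ∑ y ∈ s, w y * ‖c y - m‖ ^ 2 + ∑ y ∈ s, w y * ‖v‖ ^ 2 := by
  have h0 := sum_mul_re_inner_of_mean h v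
  have : ∀ y, w y * ‖c y - m + v‖ ^ 2 = w y * ‖c y - m‖ ^ 2 + w y * ‖v‖ ^ 2 +
      2 * (w y * (inner ℂ (c y - m) v).re) := fun y => by
    rw [norm_add_sq_complex]
    ring
  simp only [this, Finset.sum_add_distrib, ← Finset.mul_sum _ _ (2 : ℝ), h0]
  ring

end WeightedMean

namespace DiscreteDesingularization

variable {Q : Type u} {D : DiscreteDesingularization Q} {H : HilbertField D.X}

namespace GappedGraphing

variable {G : D.GappedGraphing} {π : D.UnitaryRep H} {ξ : ∀ x, H.fiber x}

theorem edgeBounded_sq_norm {P : ∀ p : D.X × D.X, H.fiber p.1}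
    (hP : (H.comap (Prod.fst : D.X × D.X → D.X) measurable_fst).MeasurableSection P) (B : ℝ)
    (hB : ∀ x, ∀ y ∈ G.nb x, ‖P (x, y)‖ ≤ B) : G.EdgeBounded fun x y => ‖P (x, y)‖ ^ 2 := by
  refine ⟨hP.sq_norm, B ^ 2, fun x y hy => ?_⟩
  rw [abs_of_nonneg (by positivity)]
  exact pow_le_pow_left₀ (norm_nonneg _) (hB x y hy) 2

theorem edgeBounded_re_inner {P P' : ∀ p : D.X × D.X, H.fiber p.1}
    (hP : (H.comap (Prod.fst : D.X × D.X → D.X) measurable_fst).MeasurableSection P)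
    (hP' : (H.comap (Prod.fst : D.X × D.X → D.X) measurable_fst).MeasurableSection P') (B B' : ℝ)
    (hB : ∀ x, ∀ y ∈ G.nb x, ‖P (x, y)‖ ≤ B) (hB' : ∀ x, ∀ y ∈ G.nb x, ‖P' (x, y)‖ ≤ B') :
    G.EdgeBounded fun x y => (inner ℂ (P (x, y)) (P' (x, y))).re := by
  refine ⟨Complex.measurable_re.comp (hP.inner hP'), B * B', fun x y hy => ?_⟩
  refine (Complex.abs_re_le_norm _).trans ((norm_inner_le_norm _ _).trans ?_)
  exact mul_le_mul (hB x y hy) (hB' x y hy) (norm_nonneg _) ((norm_nonneg _).trans (hB x y hy))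

/-! ### The drift of a section. -/

variable (G π ξ) in
/-- The weighted mean of the coboundary of a section at a vertex. -/
noncomputable def drift (x : D.X) : H.fiber x :=
  (∑ y ∈ G.nb x, G.w x y)⁻¹ • ∑ y ∈ G.nb x, G.w x y • π.coboundary ξ x y

theorem sum_w_smul_sub_drift (x : D.X) :
    ∑ y ∈ G.nb x, G.w x y • (π.coboundary ξ x y - G.drift π ξ x) = 0 := by
  simp only [smul_sub, Finset.sum_sub_distrib, ← Finset.sum_smul]
  rcases (G.nb x).eq_empty_or_nonempty with h | h
  · simp [h]
  · rw [drift, smul_inv_smul₀ (Finset.sum_pos (fun _ _ => w_pos) h).ne', sub_self]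

theorem measurableSection_drift (hξ : H.MeasurableSection ξ) :
    H.MeasurableSection (G.drift π ξ) := by
  intro n
  have h1 : Measurable fun x => ∑ y ∈ G.nb x, (G.w x y : ℂ) *
      inner ℂ (H.fundamental n x) (π.coboundary ξ x y) :=
    measurable_sum_nb ((Complex.measurable_ofReal.comp measurable_w).mul
      (π.measurableSection_coboundary hξ n))
  have h2 : Measurable fun x => (((∑ y ∈ G.nb x, G.w x y)⁻¹ : ℝ) : ℂ) :=
    Complex.measurable_ofReal.comp (measurable_sum_nb measurable_w).inv
  convert h2.mul h1 using 2 with x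
  simp only [drift, ← Complex.coe_smul, inner_smul_right, inner_sum, Pi.mul_apply]

theorem measurableSection_comap_drift (hξ : H.MeasurableSection ξ) :
    (H.comap (Prod.fst : D.X × D.X → D.X) measurable_fst).MeasurableSection
      fun p => G.drift π ξ p.1 :=
  HilbertField.measurableSection_comap H measurable_fst (measurableSection_drift hξ)

theorem norm_drift_le (hξ : ∀ x, ‖ξ x‖ ≤ 1) (x : D.X) : ‖G.drift π ξ x‖ ≤ 2 := by
  rcases (G.nb x).eq_empty_or_nonempty with h | h
  · simp [drift, h]
  · have hW : 0 < ∑ y ∈ G.nb x, G.w x y := Finset.sum_pos (fun _ _ => w_pos) h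
    rw [drift, norm_smul, norm_inv, Real.norm_of_nonneg hW.le, inv_mul_le_iff₀ hW,
      Finset.sum_mul]
    refine norm_sum_le_of_le _ fun y hy => ?_
    rw [norm_smul, Real.norm_of_nonneg w_pos.le]
    exact mul_le_mul_of_nonneg_left (π.norm_coboundary_le hξ (G.rel x y hy)) w_pos.le

/-- The new vector is a convex combination of ξ_x and the weighted mean of the transported
neighbouring vectors, so the unit ball is preserved. -/
theorem norm_add_smul_drift_le (hξ : ∀ x, ‖ξ x‖ ≤ 1) {t : ℝ} (ht0 : 0 ≤ t) (ht1 : t ≤ 1)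
    (x : D.X) : ‖ξ x + t • G.drift π ξ x‖ ≤ 1 := by
  rcases (G.nb x).eq_empty_or_nonempty with h | h
  · simpa [drift, h] using hξ x
  · have hW : 0 < ∑ y ∈ G.nb x, G.w x y := Finset.sum_pos (fun _ _ => w_pos) h
    have hmean : G.drift π ξ x =
        (∑ y ∈ G.nb x, G.w x y)⁻¹ • (∑ y ∈ G.nb x, G.w x y • π.act x y (ξ y)) - ξ x := by
      simp only [drift, UnitaryRep.coboundary, smul_sub, Finset.sum_sub_distrib,
        ← Finset.sum_smul]
      rw [inv_smul_smul₀ hW.ne']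
    have hle : ‖(∑ y ∈ G.nb x, G.w x y)⁻¹ • (∑ y ∈ G.nb x, G.w x y • π.act x y (ξ y))‖ ≤ 1 := by
      rw [norm_smul, norm_inv, Real.norm_of_nonneg hW.le, inv_mul_le_iff₀ hW, mul_one]
      refine norm_sum_le_of_le _ fun y hy => ?_
      rw [norm_smul, Real.norm_of_nonneg w_pos.le, π.norm_act (G.rel x y hy)]
      exact mul_le_of_le_one_right w_pos.le (hξ y)
    rw [hmean]
    generalize (∑ y ∈ G.nb x, G.w x y)⁻¹ • (∑ y ∈ G.nb x, G.w x y • π.act x y (ξ y)) = a at hle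
    calc ‖ξ x + t • (a - ξ x)‖ = ‖(1 - t) • ξ x + t • a‖ := by
          congr 1
          module
      _ ≤ (1 - t) * 1 + t * 1 := by
          refine (norm_add_le _ _).trans (add_le_add ?_ ?_)
          · rw [norm_smul, Real.norm_of_nonneg (by linarith)]
            exact mul_le_mul_of_nonneg_left (hξ x) (by linarith)
          · rw [norm_smul, Real.norm_of_nonneg ht0]
            exact mul_le_mul_of_nonneg_left hle ht0
      _ = 1 := by ring

/-! ### Energy, drift energy and variance. -/

variable (G π ξ) in
/-- The Dirichlet energy of a section. -/
noncomputable def energy : ℝ := G.edgeIntegral fun x y => G.w x y * ‖π.coboundary ξ x y‖ ^ 2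

variable (G π ξ) in
/-- The square norm of the drift. -/
noncomputable def driftEnergy : ℝ := G.edgeIntegral fun x y => G.w x y * ‖G.drift π ξ x‖ ^ 2

variable (G π ξ) in
/-- The integrated variance of the coboundary in the links. -/
noncomputable def varianceEnergy : ℝ :=
  G.edgeIntegral fun x y => G.w x y * ‖π.coboundary ξ x y - G.drift π ξ x‖ ^ 2

theorem energy_nonneg : 0 ≤ G.energy π ξ :=
  edgeIntegral_nonneg fun _ _ _ => mul_nonneg w_pos.le (by positivity)

theorem driftEnergy_nonneg : 0 ≤ G.driftEnergy π ξ :=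
  edgeIntegral_nonneg fun _ _ _ => mul_nonneg w_pos.le (by positivity)

theorem varianceEnergy_nonneg : 0 ≤ G.varianceEnergy π ξ :=
  edgeIntegral_nonneg fun _ _ _ => mul_nonneg w_pos.le (by positivity)

theorem edgeIntegral_inner_drift :
    G.edgeIntegral (fun x y => G.w x y * (inner ℂ (π.coboundary ξ x y) (G.drift π ξ x)).re) =
      G.driftEnergy π ξ := by
  refine edgeIntegral_congr_sum fun x => ?_
  have h := sum_mul_re_inner_of_mean (sum_w_smul_sub_drift (G := G) (π := π) (ξ := ξ) x)
    (G.drift π ξ x)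
  have h2 : ∀ v : H.fiber x, (inner ℂ v v).re = ‖v‖ ^ 2 :=
    fun v => @inner_self_eq_norm_sq ℂ _ _ _ _ v
  simp only [inner_sub_left, Complex.sub_re, mul_sub, Finset.sum_sub_distrib, h2] at h
  linarith

section Bounded

variable (hξ : H.MeasurableSection ξ) (hξ1 : ∀ x, ‖ξ x‖ ≤ 1)

include hξ hξ1

theorem edgeBounded_coboundary : G.EdgeBounded fun x y => ‖π.coboundary ξ x y‖ ^ 2 :=
  edgeBounded_sq_norm (P := fun p => π.coboundary ξ p.1 p.2) (π.measurableSection_coboundary hξ) 2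
    fun x y hy => π.norm_coboundary_le hξ1 (G.rel x y hy)

theorem edgeBounded_drift : G.EdgeBounded fun x _ => ‖G.drift π ξ x‖ ^ 2 :=
  edgeBounded_sq_norm (P := fun p => G.drift π ξ p.1)
    (measurableSection_comap_drift hξ) 2 fun x _ _ => norm_drift_le hξ1 x

theorem edgeBounded_sub_drift :
    G.EdgeBounded fun x y => ‖π.coboundary ξ x y - G.drift π ξ x‖ ^ 2 :=
  edgeBounded_sq_norm (P := fun p => π.coboundary ξ p.1 p.2 - G.drift π ξ p.1)
    ((π.measurableSection_coboundary hξ).sub (measurableSection_comap_drift hξ))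
    (2 + 2) fun x y hy => (norm_sub_le _ _).trans (add_le_add
      (π.norm_coboundary_le hξ1 (G.rel x y hy)) (norm_drift_le hξ1 x))

theorem edgeBounded_inner_drift :
    G.EdgeBounded fun x y => (inner ℂ (π.coboundary ξ x y) (G.drift π ξ x)).re :=
  edgeBounded_re_inner (P := fun p => π.coboundary ξ p.1 p.2) (P' := fun p => G.drift π ξ p.1)
    (π.measurableSection_coboundary hξ) (measurableSection_comap_drift hξ) 2 2
    (fun x y hy => π.norm_coboundary_le hξ1 (G.rel x y hy)) fun x _ _ => norm_drift_le hξ1 x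

theorem edgeBounded_inner_act_drift :
    G.EdgeBounded fun x y => (inner ℂ (π.coboundary ξ x y) (π.act x y (G.drift π ξ y))).re :=
  edgeBounded_re_inner (P := fun p => π.coboundary ξ p.1 p.2)
    (P' := fun p => π.act p.1 p.2 (G.drift π ξ p.2))
    (π.measurableSection_coboundary hξ) (π.measurableSection_act (measurableSection_drift hξ)) 2 2
    (fun x y hy => π.norm_coboundary_le hξ1 (G.rel x y hy)) fun x y hy => by
      rw [π.norm_act (G.rel x y hy)]
      exact norm_drift_le hξ1 y

theorem energy_eq : G.energy π ξ = G.varianceEnergy π ξ + G.driftEnergy π ξ := by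
  rw [energy, varianceEnergy, driftEnergy, ← edgeIntegral_add
    (EdgeBounded.weight.mul (edgeBounded_sub_drift hξ hξ1))
    (EdgeBounded.weight.mul (edgeBounded_drift hξ hξ1))]
  refine edgeIntegral_congr_sum fun x => ?_
  rw [Finset.sum_add_distrib, ← sum_mul_norm_add_sq_of_mean (sum_w_smul_sub_drift x)]
  simp only [sub_add_cancel]

/-- The link gap at x bounds the variance by half the sum of |c(y,z)|² over ordered opposite edges.
Transport from x to y costs the factor `bound`, and afterwards each edge is counted once per
triangle containing it, hence at most w times. -/
theorem lam_mul_varianceEnergy_le :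
    G.lam * G.varianceEnergy π ξ ≤ G.bound / 2 * G.energy π ξ := by
  classical
  let F : D.X → D.X → ℝ := fun x y =>
    ∑ z ∈ G.nb x, if G.tri x y z then ‖π.coboundary ξ y z‖ ^ 2 else 0
  have hFm : Measurable (Function.uncurry F) := by
    refine measurable_sum_nb_fst (Measurable.ite measurableSet_tri' ?_ measurable_const)
    exact (π.measurableSection_coboundary hξ).sq_norm.comp
      ((measurable_snd.comp measurable_fst).prodMk measurable_snd)
  have hF0 : ∀ x y, 0 ≤ F x y := fun x y => Finset.sum_nonneg fun z _ => by
    split_ifs <;> positivity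
  have hF : G.EdgeBounded F := by
    refine ⟨hFm, G.N * 4, fun x y hy => ?_⟩
    rw [abs_of_nonneg (hF0 x y)]
    refine (Finset.sum_le_card_nsmul _ _ 4 fun z hz => ?_).trans ?_
    · split_ifs with h
      · have := π.norm_coboundary_le hξ1 (x := y) (y := z)
          ((G.rel x y hy).symm'.trans' (G.rel x z hz))
        nlinarith [norm_nonneg (π.coboundary ξ y z)]
      · norm_num
    · rw [nsmul_eq_mul]
      exact mul_le_mul_of_nonneg_right (by exact_mod_cast G.card_le x) (by norm_num)
  have h1 : G.lam * G.varianceEnergy π ξ ≤ 2⁻¹ * G.edgeIntegral F := by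
    rw [varianceEnergy, ← edgeIntegral_const_mul, ← edgeIntegral_const_mul]
    refine edgeIntegral_mono_sum
      ((EdgeBounded.const _).mul (EdgeBounded.weight.mul (edgeBounded_sub_drift hξ hξ1)))
      ((EdgeBounded.const _).mul hF) fun x => ?_
    rw [← Finset.mul_sum, ← Finset.mul_sum]
    refine (G.gap x _ (π.coboundary ξ x) (G.drift π ξ x) (sum_w_smul_sub_drift x)).trans
      (le_of_eq ?_)
    congr 1
    refine Finset.sum_congr rfl fun y hy => Finset.sum_congr rfl fun z hz => ?_
    rw [π.norm_coboundary_sub ξ (G.rel x y hy) ((G.rel x y hy).symm'.trans' (G.rel x z hz))]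
  have h2 : G.edgeIntegral F ≤ G.bound * G.energy π ξ := by
    rw [edgeIntegral_transport hF, energy, ← edgeIntegral_const_mul]
    refine edgeIntegral_mono_sum (hF.mul .cocycle).swap
      ((EdgeBounded.const _).mul (EdgeBounded.weight.mul (edgeBounded_coboundary hξ hξ1)))
      fun x => ?_
    -- After transport the base point is an end of the measured edge (x,z), and y is the third
    -- vertex of the triangle; summing over y counts the triangles on that edge.
    have hFswap : ∀ y ∈ G.nb x, F y x =
        ∑ z ∈ G.nb x, if G.tri x z y then ‖π.coboundary ξ x z‖ ^ 2 else 0 := by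
      intro y hy
      simp only [F, ← Finset.sum_filter]
      refine Finset.sum_congr ?_ fun _ _ => rfl
      ext z
      simp only [Finset.mem_filter]
      constructor
      · rintro ⟨-, h⟩
        have h' := G.tri_rot _ _ _ h
        exact ⟨tri_mem' h', G.tri_swap _ _ _ h'⟩
      · rintro ⟨-, h⟩
        have h' := G.tri_rot _ _ _ (G.tri_swap _ _ _ h)
        exact ⟨tri_mem' h', h'⟩
    calc ∑ y ∈ G.nb x, F y x * G.δ y x ≤ ∑ y ∈ G.nb x, G.bound * F y x := by
          refine Finset.sum_le_sum fun y hy => ?_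
          rw [mul_comm]
          exact mul_le_mul_of_nonneg_right (G.δ_le y x (G.nb_symm x y hy)) (hF0 y x)
      _ = G.bound * ∑ z ∈ G.nb x, ∑ y ∈ G.nb x,
          (if G.tri x z y then ‖π.coboundary ξ x z‖ ^ 2 else 0) := by
          rw [← Finset.mul_sum, Finset.sum_congr rfl hFswap, Finset.sum_comm]
      _ ≤ ∑ z ∈ G.nb x, G.bound * (G.w x z * ‖π.coboundary ξ x z‖ ^ 2) := by
          rw [Finset.mul_sum]
          refine Finset.sum_le_sum fun z _ => mul_le_mul_of_nonneg_left ?_ bound_pos.le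
          rw [← Finset.sum_filter, Finset.sum_const, nsmul_eq_mul]
          exact mul_le_mul_of_nonneg_right (le_max_left _ _) (by positivity)
  linarith

/-- Exchanging the ends of an edge replaces c by its negative up to the unitary action, which turns
the drift at y into the drift at x at the price of the density δ. -/
theorem edgeIntegral_inner_act_drift :
    G.edgeIntegral (fun x y => G.w x y *
      (inner ℂ (π.coboundary ξ x y) (π.act x y (G.drift π ξ y))).re) =
    -G.edgeIntegral (fun x y => G.δ y x * (G.w x y *
      (inner ℂ (π.coboundary ξ x y) (G.drift π ξ x)).re)) := by
  rw [edgeIntegral_transport (EdgeBounded.weight.mul (edgeBounded_inner_act_drift hξ hξ1)),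
    ← neg_one_mul (G.edgeIntegral _), ← edgeIntegral_const_mul]
  refine edgeIntegral_congr fun x y hy => ?_
  have hr := G.rel x y hy
  rw [π.coboundary_symm ξ hr, inner_neg_left, π.inner_act hr.symm', Complex.neg_re, w_symm]
  ring

theorem edgeIntegral_norm_drift_snd_le :
    G.edgeIntegral (fun x y => G.w x y * ‖G.drift π ξ y‖ ^ 2) ≤
      G.bound * G.driftEnergy π ξ := by
  have h0 := (edgeBounded_drift (G := G) (π := π) hξ hξ1)
  rw [edgeIntegral_transport (EdgeBounded.weight.mul h0.swap), driftEnergy,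
    ← edgeIntegral_const_mul]
  refine edgeIntegral_mono ((EdgeBounded.weight.mul h0.swap).mul .cocycle).swap
    ((EdgeBounded.const _).mul (EdgeBounded.weight.mul h0)) fun x y hy => ?_
  rw [w_symm, mul_comm]
  exact mul_le_mul_of_nonneg_right (G.δ_le y x (G.nb_symm x y hy))
    (mul_nonneg w_pos.le (by positivity))

/-- Re⟨c,m⟩ has no sign, so the bounds on δ cannot be applied to it directly. They are applied to
the two squares in 4Re⟨c,m⟩ = |c+m|² - |c-m|²: the lower bound to the first, the upper bound to the
second. Writing c+m = (c-m) + 2m gives V + 4M for the first integral. -/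
theorem le_edgeIntegral_inner_drift :
    4⁻¹ * (G.bound⁻¹ * (G.varianceEnergy π ξ + 4 * G.driftEnergy π ξ) -
      G.bound * G.varianceEnergy π ξ) ≤
    G.edgeIntegral (fun x y => G.δ y x * (G.w x y *
      (inner ℂ (π.coboundary ξ x y) (G.drift π ξ x)).re)) := by
  let P : D.X → D.X → ℝ := fun x y => ‖π.coboundary ξ x y + G.drift π ξ x‖ ^ 2
  have hPb : G.EdgeBounded P :=
    edgeBounded_sq_norm (P := fun p => π.coboundary ξ p.1 p.2 + G.drift π ξ p.1)
      ((π.measurableSection_coboundary hξ).add (measurableSection_comap_drift hξ))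
      (2 + 2) fun x y hy => (norm_add_le _ _).trans (add_le_add
        (π.norm_coboundary_le hξ1 (G.rel x y hy)) (norm_drift_le hξ1 x))
  have hP : G.edgeIntegral (fun x y => G.w x y * P x y) =
      G.varianceEnergy π ξ + 4 * G.driftEnergy π ξ := by
    rw [varianceEnergy, driftEnergy, ← edgeIntegral_const_mul, ← edgeIntegral_add
      (EdgeBounded.weight.mul (edgeBounded_sub_drift hξ hξ1))
      ((EdgeBounded.const _).mul (EdgeBounded.weight.mul (edgeBounded_drift hξ hξ1)))]
    refine edgeIntegral_congr_sum fun x => ?_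
    have h := sum_mul_norm_add_sq_of_mean (sum_w_smul_sub_drift (G := G) (π := π) (ξ := ξ) x)
      ((2 : ℝ) • G.drift π ξ x)
    have hp : ∀ y, P x y =
        ‖π.coboundary ξ x y - G.drift π ξ x + (2 : ℝ) • G.drift π ξ x‖ ^ 2 := fun y => by
      have : π.coboundary ξ x y + G.drift π ξ x =
          π.coboundary ξ x y - G.drift π ξ x + (2 : ℝ) • G.drift π ξ x := by module
      rw [← this]
    have hq : ∀ y, G.w x y * ‖(2 : ℝ) • G.drift π ξ x‖ ^ 2 =
        4 * (G.w x y * ‖G.drift π ξ x‖ ^ 2) := fun y => by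
      rw [norm_smul, mul_pow]
      norm_num
      ring
    simp only [hq] at h
    simp only [hp]
    rw [Finset.sum_add_distrib]
    exact h
  rw [← hP, varianceEnergy, mul_sub, sub_eq_add_neg, ← edgeIntegral_const_mul G.bound⁻¹,
    ← edgeIntegral_const_mul, ← edgeIntegral_const_mul, ← edgeIntegral_const_mul,
    ← neg_one_mul, ← edgeIntegral_const_mul]
  have hb1 := (EdgeBounded.const 4⁻¹).mul ((EdgeBounded.const G.bound⁻¹).mul
    (EdgeBounded.weight.mul hPb))
  have hb2 := (EdgeBounded.const (-1)).mul ((EdgeBounded.const 4⁻¹).mul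
    ((EdgeBounded.const G.bound).mul (EdgeBounded.weight.mul
      (edgeBounded_sub_drift (G := G) (π := π) hξ hξ1))))
  rw [← edgeIntegral_add hb1 hb2]
  refine edgeIntegral_mono (hb1.add hb2) (EdgeBounded.cocycle.swap.mul
    (EdgeBounded.weight.mul (edgeBounded_inner_drift hξ hξ1))) fun x y hy => ?_
  have hy' := G.nb_symm x y hy
  have hadd := norm_add_sq_complex (π.coboundary ξ x y) (G.drift π ξ x)
  have hsub := @norm_sub_sq ℂ _ _ _ _ (π.coboundary ξ x y) (G.drift π ξ x)
  rw [RCLike.re_to_complex] at hsub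
  have hin : (inner ℂ (π.coboundary ξ x y) (G.drift π ξ x)).re =
      4⁻¹ * (P x y - ‖π.coboundary ξ x y - G.drift π ξ x‖ ^ 2) := by
    simp only [P]
    rw [hadd, hsub]
    ring
  rw [hin]
  have h1 := mul_le_mul_of_nonneg_right (G.le_δ y x hy')
    (mul_nonneg (w_pos (G := G) (x := x) (y := y)).le (sq_nonneg ‖π.coboundary ξ x y + G.drift π ξ x‖))
  have h2 := mul_le_mul_of_nonneg_right (G.δ_le y x hy')
    (mul_nonneg (w_pos (G := G) (x := x) (y := y)).le (sq_nonneg ‖π.coboundary ξ x y - G.drift π ξ x‖))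
  simp only [P]
  linarith

/-- The new coboundary is c + t(π m_y - m_x). Its linear term is controlled by the two preceding
facts on Re⟨c, π m_y⟩ and Re⟨c, m_x⟩. The quadratic term uses |u - v|² ≤ 2|u|² + 2|v|², and
transporting |m_y|² to x accounts for the summand `bound` in 1 + `bound`. -/
theorem energy_add_smul_drift_le {t : ℝ} (ht : 0 ≤ t) (ht1 : t ≤ 1) :
    G.energy π (fun x => ξ x + t • G.drift π ξ x) ≤ G.energy π ξ +
      2 * t * (-(4⁻¹ * (G.bound⁻¹ * (G.varianceEnergy π ξ + 4 * G.driftEnergy π ξ) -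
        G.bound * G.varianceEnergy π ξ)) - G.driftEnergy π ξ) +
      2 * t ^ 2 * ((1 + G.bound) * G.driftEnergy π ξ) := by
  have hm : H.MeasurableSection fun x => ξ x + t • G.drift π ξ x := by
    have := hξ.add ((measurableSection_drift (G := G) (π := π) hξ).smul
      (measurable_const (a := (t : ℂ))))
    simpa only [Complex.coe_smul] using this
  have b1 := EdgeBounded.weight.mul (edgeBounded_coboundary (G := G) (π := π) hξ hξ1)
  have b2 := EdgeBounded.weight.mul (edgeBounded_inner_act_drift (G := G) (π := π) hξ hξ1)
  have b3 := EdgeBounded.weight.mul (edgeBounded_inner_drift (G := G) (π := π) hξ hξ1)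
  have b4 := EdgeBounded.weight.mul (edgeBounded_drift (G := G) (π := π) hξ hξ1)
  have b5 := EdgeBounded.weight.mul (edgeBounded_drift (G := G) (π := π) hξ hξ1).swap
  have key : G.energy π (fun x => ξ x + t • G.drift π ξ x) ≤
      G.energy π ξ + 2 * t * G.edgeIntegral (fun x y => G.w x y *
      (inner ℂ (π.coboundary ξ x y) (π.act x y (G.drift π ξ y))).re) +
      -(2 * t) * G.edgeIntegral (fun x y => G.w x y *
      (inner ℂ (π.coboundary ξ x y) (G.drift π ξ x)).re) +
      2 * t ^ 2 * G.driftEnergy π ξ +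
      2 * t ^ 2 * G.edgeIntegral (fun x y => G.w x y * ‖G.drift π ξ y‖ ^ 2) := by
    have c2 := (EdgeBounded.const (2 * t)).mul b2
    have c3 := (EdgeBounded.const (-(2 * t))).mul b3
    have c4 := (EdgeBounded.const (2 * t ^ 2)).mul b4
    have c5 := (EdgeBounded.const (2 * t ^ 2)).mul b5
    rw [energy, energy, driftEnergy, ← edgeIntegral_const_mul, ← edgeIntegral_const_mul,
      ← edgeIntegral_const_mul, ← edgeIntegral_const_mul, ← edgeIntegral_add b1 c2,
      ← edgeIntegral_add (b1.add c2) c3, ← edgeIntegral_add ((b1.add c2).add c3) c4,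
      ← edgeIntegral_add (((b1.add c2).add c3).add c4) c5]
    refine edgeIntegral_mono
      (EdgeBounded.weight.mul (edgeBounded_coboundary hm
        (norm_add_smul_drift_le hξ1 ht ht1)))
      ((((b1.add c2).add c3).add c4).add c5) fun x y hy => ?_
    have hr := G.rel x y hy
    have hc : π.coboundary (fun x => ξ x + t • G.drift π ξ x) x y =
        π.coboundary ξ x y + t • (π.act x y (G.drift π ξ y) - G.drift π ξ x) := by
      simp only [UnitaryRep.coboundary, map_add, smul_sub]
      rw [← Complex.coe_smul, map_smul, Complex.coe_smul]
      abel
    have h1 : ‖π.act x y (G.drift π ξ y) - G.drift π ξ x‖ ^ 2 ≤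
        2 * ‖G.drift π ξ y‖ ^ 2 + 2 * ‖G.drift π ξ x‖ ^ 2 := by
      have := norm_sub_le (π.act x y (G.drift π ξ y)) (G.drift π ξ x)
      rw [π.norm_act hr] at this
      nlinarith [sq_nonneg (‖G.drift π ξ y‖ - ‖G.drift π ξ x‖),
        norm_nonneg (π.act x y (G.drift π ξ y) - G.drift π ξ x)]
    rw [hc, norm_add_sq_complex, re_inner_real_smul_right, inner_sub_right, Complex.sub_re,
      norm_smul, mul_pow, Real.norm_eq_abs, sq_abs]
    have h2 := mul_le_mul_of_nonneg_left h1
      (mul_nonneg (w_pos (G := G) (x := x) (y := y)).le (sq_nonneg t))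
    linarith
  have k1 := edgeIntegral_inner_act_drift (G := G) (π := π) hξ hξ1
  have k2 := edgeIntegral_norm_drift_snd_le (G := G) (π := π) hξ hξ1
  have k3 := edgeIntegral_inner_drift (G := G) (π := π) (ξ := ξ)
  have k4 := le_edgeIntegral_inner_drift (G := G) (π := π) hξ hξ1
  rw [k1, k3] at key
  have k4' := mul_le_mul_of_nonneg_left k4 (by positivity : (0 : ℝ) ≤ 2 * t)
  have k2' := mul_le_mul_of_nonneg_left k2 (by positivity : (0 : ℝ) ≤ 2 * t ^ 2)
  linarith

end Bounded

/-! ### Contraction of the energy under averaging. -/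

variable (G) in
/-- The step of the averaging process. -/
noncomputable def step : ℝ := (4 * (1 + G.bound))⁻¹

theorem step_pos : 0 < G.step := inv_pos.2 (by linarith [G.one_le_bound])

theorem step_le_one : G.step ≤ 1 := inv_le_one_of_one_le₀ (by linarith [G.one_le_bound])

variable (G) in
/-- The gap of the averaging process. -/
noncomputable def kappa : ℝ := 1 - G.bound / (2 * G.lam)

theorem lam_pos : 0 < G.lam := lt_of_le_of_lt (by have := G.one_le_bound; positivity) G.lt_lam

theorem kappa_pos : 0 < G.kappa := by
  have h1 := G.one_le_bound
  have h2 := G.lt_lam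
  have h3 : G.bound ≤ G.bound ^ 3 := le_self_pow₀ h1 (by norm_num)
  rw [kappa, sub_pos, div_lt_one (by linarith [G.lam_pos])]
  linarith

theorem kappa_le_one : G.kappa ≤ 1 := by
  have := div_nonneg G.bound_pos.le (by linarith [G.lam_pos] : 0 ≤ 2 * G.lam)
  rw [kappa]
  linarith

theorem driftEnergy_le_energy (hξ : H.MeasurableSection ξ) (hξ1 : ∀ x, ‖ξ x‖ ≤ 1) :
    G.driftEnergy π ξ ≤ G.energy π ξ := by
  have := energy_eq (G := G) (π := π) hξ hξ1
  linarith [G.varianceEnergy_nonneg (π := π) (ξ := ξ)]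

/-- With t the step, the linear term gains at least 3tM/2 and the quadratic term loses tM/2; the net
gain tM is at least tκE. -/
theorem energy_averaging_le (hξ : H.MeasurableSection ξ) (hξ1 : ∀ x, ‖ξ x‖ ≤ 1) :
    G.energy π (fun x => ξ x + G.step • G.drift π ξ x) ≤
      (1 - G.step * G.kappa) * G.energy π ξ := by
  have h1 := energy_eq (G := G) (π := π) hξ hξ1
  have h2 := lam_mul_varianceEnergy_le (G := G) (π := π) hξ hξ1
  have h3 := energy_add_smul_drift_le (G := G) (π := π) hξ hξ1 G.step_pos.le G.step_le_one
  have hV := G.varianceEnergy_nonneg (π := π) (ξ := ξ)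
  have hM := G.driftEnergy_nonneg (π := π) (ξ := ξ)
  have hE := G.energy_nonneg (π := π) (ξ := ξ)
  set E := G.energy π ξ
  set V := G.varianceEnergy π ξ
  set M := G.driftEnergy π ξ
  have hb := G.one_le_bound
  have hb0 := G.bound_pos
  have hl := G.lt_lam
  have hl0 := G.lam_pos
  have ht : G.step * (4 * (1 + G.bound)) = 1 := inv_mul_cancel₀ (by linarith)
  have ht0 := G.step_pos
  have hkappa : G.kappa * E ≤ M := by
    have : V ≤ G.bound / (2 * G.lam) * E := by
      rw [div_mul_eq_mul_div, le_div_iff₀ (by linarith)]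
      linarith
    rw [kappa]
    linarith
  -- The cube in the hypothesis on `lam` is needed in full here; `kappa_pos` only needs `lam` >
  -- `bound` / 2.
  have hVE : G.bound ^ 2 * V ≤ E := by
    have h4 : G.bound ^ 3 / 2 * V ≤ G.bound / 2 * E :=
      (mul_le_mul_of_nonneg_right hl.le hV).trans h2
    have h5 : G.bound * (G.bound ^ 2 * V) ≤ G.bound * E := by nlinarith
    exact le_of_mul_le_mul_left h5 hb0
  have hVM : (G.bound - G.bound⁻¹) * V ≤ M := by
    have h6 : G.bound * ((G.bound - G.bound⁻¹) * V) ≤ G.bound * M := by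
      have : G.bound * ((G.bound - G.bound⁻¹) * V) = G.bound ^ 2 * V - V := by
        field_simp
      rw [this]
      nlinarith
    exact le_of_mul_le_mul_left h6 hb0
  have hinv : 0 ≤ G.bound⁻¹ * M := mul_nonneg (inv_nonneg.2 hb0.le) hM
  -- The constant 4 in the step is chosen so that the quadratic term uses only a third of the linear
  -- gain.
  have hsq : 2 * G.step ^ 2 * ((1 + G.bound) * M) = G.step * M / 2 := by
    have : G.step * (1 + G.bound) = 1 / 4 := by linarith
    calc _ = 2 * (G.step * (1 + G.bound)) * (G.step * M) := by ring
      _ = _ := by rw [this]; ring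
  have hcross : -(4⁻¹ * (G.bound⁻¹ * (V + 4 * M) - G.bound * V)) - M ≤ -(3 / 4) * M := by
    linarith
  have h7 := mul_le_mul_of_nonneg_left hcross (by positivity : 0 ≤ 2 * G.step)
  have h8 := mul_le_mul_of_nonneg_left hkappa ht0.le
  linarith

end GappedGraphing

end DiscreteDesingularization

/-! ### Invariant sections as limits of averages -/

theorem sq_integral_le_integral_sq {X : Type*} [MeasurableSpace X] (μ : Measure X)
    [IsProbabilityMeasure μ] {f : X → ℝ} (hf : Integrable f μ)
    (hf2 : Integrable (fun x => f x ^ 2) μ) : (∫ x, f x ∂μ) ^ 2 ≤ ∫ x, f x ^ 2 ∂μ := by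
  set c := ∫ x, f x ∂μ with hc
  have h0 : 0 ≤ ∫ x, (f x - c) ^ 2 ∂μ := integral_nonneg fun x => sq_nonneg _
  have h1 : ∀ x, (f x - c) ^ 2 = f x ^ 2 - 2 * c * f x + c ^ 2 := fun x => by ring
  simp only [h1] at h0
  have hi : Integrable (fun x => f x ^ 2 - 2 * c * f x) μ := hf2.sub (hf.const_mul _)
  rw [integral_add hi (integrable_const _), integral_sub hf2 (hf.const_mul _), integral_const_mul, ← hc] at h0
  simp at h0
  linarith

namespace DiscreteDesingularization

variable {Q : Type u} {D : DiscreteDesingularization Q} {H : HilbertField D.X}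

namespace GappedGraphing

variable {G : D.GappedGraphing} {π : D.UnitaryRep H} {ξ : ∀ x, H.fiber x}

/-- Cauchy–Schwarz on a probability space, then w ≥ 1; at a vertex without neighbours the drift
vanishes. -/
theorem integral_norm_drift_le (hξ : H.MeasurableSection ξ) (hξ1 : ∀ x, ‖ξ x‖ ≤ 1) :
    ∫ x, ‖G.drift π ξ x‖ ∂D.μ ≤ √(G.energy π ξ) := by
  have hm := (measurableSection_drift (G := G) (π := π) hξ).norm
  have hi : Integrable (fun x => ‖G.drift π ξ x‖) D.μ :=
    Integrable.of_bound hm.aestronglyMeasurable 2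
      (Eventually.of_forall fun x => by rw [norm_norm]; exact norm_drift_le hξ1 x)
  have hi2 : Integrable (fun x => ‖G.drift π ξ x‖ ^ 2) D.μ :=
    Integrable.of_bound (hm.pow_const 2).aestronglyMeasurable (2 ^ 2)
      (Eventually.of_forall fun x => by
        rw [norm_pow, norm_norm]
        exact pow_le_pow_left₀ (norm_nonneg _) (norm_drift_le hξ1 x) 2)
  refine Real.le_sqrt_of_sq_le ((sq_integral_le_integral_sq D.μ hi hi2).trans
    (le_trans ?_ (driftEnergy_le_energy hξ hξ1)))
  refine integral_mono hi2 (EdgeBounded.weight.mul (edgeBounded_drift hξ hξ1)).integrable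
    fun x => ?_
  rcases (G.nb x).eq_empty_or_nonempty with h | ⟨y, hy⟩
  · simp [drift, h]
  · refine le_trans ?_ (Finset.single_le_sum
      (f := fun y => G.w x y * ‖G.drift π ξ x‖ ^ 2)
      (fun _ _ => mul_nonneg w_pos.le (sq_nonneg _)) hy)
    exact le_mul_of_one_le_left (sq_nonneg _) one_le_w

/-! ### Iterated averages and their limit. -/

variable (G π ξ) in
/-- The iterated averages of a section along the lazy weighted random walk. -/
noncomputable def averages : ℕ → ∀ x, H.fiber x
  | 0 => ξ
  | k + 1 => fun x => averages k x + G.step • G.drift π (averages k) x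

theorem averages_spec (hξ : H.MeasurableSection ξ) (hξ1 : ∀ x, ‖ξ x‖ ≤ 1) (k : ℕ) :
    H.MeasurableSection (G.averages π ξ k) ∧ (∀ x, ‖G.averages π ξ k x‖ ≤ 1) ∧
      G.energy π (G.averages π ξ k) ≤ (1 - G.step * G.kappa) ^ k * G.energy π ξ := by
  induction k with
  | zero => exact ⟨hξ, hξ1, by simp [averages]⟩
  | succ k ih =>
    obtain ⟨h1, h2, h3⟩ := ih
    refine ⟨?_, norm_add_smul_drift_le h2 G.step_pos.le G.step_le_one, ?_⟩
    · have := h1.add ((measurableSection_drift (G := G) (π := π) h1).smul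
        (measurable_const (a := (G.step : ℂ))))
      simp only [Complex.coe_smul] at this
      exact this
    · have hq : 0 ≤ 1 - G.step * G.kappa := by
        have := mul_le_one₀ G.step_le_one G.kappa_pos.le G.kappa_le_one
        linarith
      rw [pow_succ', mul_assoc]
      exact (energy_averaging_le h1 h2).trans (mul_le_mul_of_nonneg_left h3 hq)

variable (G) in
/-- The ratio of the geometric convergence of the averages. -/
noncomputable def rate : ℝ := √(1 - G.step * G.kappa)

theorem rate_nonneg : 0 ≤ G.rate := Real.sqrt_nonneg _

theorem rate_lt_one : G.rate < 1 := by
  rw [rate, Real.sqrt_lt' one_pos]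
  have := mul_pos G.step_pos G.kappa_pos
  linarith

theorem rate_sq : G.rate ^ 2 = 1 - G.step * G.kappa := Real.sq_sqrt (by
  have := mul_le_one₀ G.step_le_one G.kappa_pos.le G.kappa_le_one
  linarith)

variable (G π ξ) in
/-- The total length of the path of averages. -/
noncomputable def pathLength (x : D.X) : ℝ≥0∞ :=
  ∑' k, ENNReal.ofReal ‖G.drift π (G.averages π ξ k) x‖

theorem measurable_pathLength (hξ : H.MeasurableSection ξ) (hξ1 : ∀ x, ‖ξ x‖ ≤ 1) :
    Measurable (G.pathLength π ξ) :=
  Measurable.tsum fun k => ENNReal.measurable_ofReal.comp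
    (measurableSection_drift (averages_spec hξ hξ1 k).1).norm

/-- The mean length of the k-th drift is at most √E(ξ) times the k-th power of the rate, so the
lengths sum as a geometric series. -/
theorem lintegral_pathLength_le (hξ : H.MeasurableSection ξ) (hξ1 : ∀ x, ‖ξ x‖ ≤ 1) :
    ∫⁻ x, G.pathLength π ξ x ∂D.μ ≤ ENNReal.ofReal (√(G.energy π ξ) * (1 - G.rate)⁻¹) := by
  have hs := averages_spec (G := G) (π := π) hξ hξ1
  have hm : ∀ k, Measurable fun x => ‖G.drift π (G.averages π ξ k) x‖ := fun k =>
    (measurableSection_drift (hs k).1).norm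
  have hk : ∀ k, ∫⁻ x, ENNReal.ofReal ‖G.drift π (G.averages π ξ k) x‖ ∂D.μ ≤
      ENNReal.ofReal (√(G.energy π ξ) * G.rate ^ k) := by
    intro k
    rw [← ofReal_integral_eq_lintegral_ofReal
      (Integrable.of_bound (hm k).aestronglyMeasurable 2
        (Eventually.of_forall fun x => by rw [norm_norm]; exact norm_drift_le (hs k).2.1 x))
      (Eventually.of_forall fun x => norm_nonneg _)]
    refine ENNReal.ofReal_le_ofReal ((integral_norm_drift_le (hs k).1 (hs k).2.1).trans ?_)
    rw [Real.sqrt_le_left (mul_nonneg (Real.sqrt_nonneg _) (pow_nonneg G.rate_nonneg k)),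
      mul_pow, Real.sq_sqrt G.energy_nonneg, ← pow_mul, mul_comm k 2, pow_mul, rate_sq, mul_comm]
    exact (hs k).2.2
  unfold pathLength
  rw [lintegral_tsum fun k => (hm k).ennreal_ofReal.aemeasurable]
  refine (ENNReal.tsum_le_tsum hk).trans (le_of_eq ?_)
  rw [← ENNReal.ofReal_tsum_of_nonneg
    (fun k => mul_nonneg (Real.sqrt_nonneg _) (pow_nonneg G.rate_nonneg k))
    ((summable_geometric_of_lt_one G.rate_nonneg G.rate_lt_one).mul_left _), tsum_mul_left,
    tsum_geometric_of_lt_one G.rate_nonneg G.rate_lt_one]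

theorem dist_averages_le (k : ℕ) (x : D.X) :
    dist (G.averages π ξ k x) (G.averages π ξ k.succ x) ≤ ‖G.drift π (G.averages π ξ k) x‖ := by
  change dist _ (G.averages π ξ k x + G.step • G.drift π (G.averages π ξ k) x) ≤ _
  rw [dist_self_add_right, norm_smul, Real.norm_of_nonneg G.step_pos.le]
  exact mul_le_of_le_one_left (norm_nonneg _) G.step_le_one

theorem summable_norm_drift {x : D.X} (hx : G.pathLength π ξ x ≠ ∞) :
    Summable fun k => ‖G.drift π (G.averages π ξ k) x‖ := by
  have := ENNReal.summable_toReal hx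
  simpa only [ENNReal.toReal_ofReal (norm_nonneg _)] using this

open Classical in
variable (G π ξ) in
/-- The limit of the averages. -/
noncomputable def limitSection (x : D.X) : H.fiber x :=
  if h : G.pathLength π ξ x ≠ ∞ then
    (cauchySeq_tendsto_of_complete (cauchySeq_of_dist_le_of_summable _
      (fun k => G.dist_averages_le (π := π) (ξ := ξ) k x) (summable_norm_drift h))).choose
  else 0

theorem tendsto_averages {x : D.X} (hx : G.pathLength π ξ x ≠ ∞) :
    Tendsto (fun k => G.averages π ξ k x) atTop (𝓝 (G.limitSection π ξ x)) := by
  rw [limitSection, dif_pos hx]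
  exact (cauchySeq_tendsto_of_complete (cauchySeq_of_dist_le_of_summable _
    (fun k => G.dist_averages_le (π := π) (ξ := ξ) k x) (summable_norm_drift hx))).choose_spec

theorem measurableSection_limitSection (hξ : H.MeasurableSection ξ) (hξ1 : ∀ x, ‖ξ x‖ ≤ 1) :
    H.MeasurableSection (G.limitSection π ξ) := by
  classical
  intro n
  have hS : MeasurableSet {x | G.pathLength π ξ x ≠ ∞} :=
    (measurable_pathLength hξ hξ1 (measurableSet_singleton ∞)).compl
  refine measurable_of_tendsto_metrizable (f := fun k x => if G.pathLength π ξ x ≠ ∞ then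
    inner ℂ (H.fundamental n x) (G.averages π ξ k x) else 0)
    (fun k => Measurable.ite hS ((averages_spec hξ hξ1 k).1 n) measurable_const) ?_
  rw [tendsto_pi_nhds]
  intro x
  by_cases hx : G.pathLength π ξ x ≠ ∞
  · simp only [if_pos hx]
    exact tendsto_const_nhds.inner (tendsto_averages hx)
  · simp only [if_neg hx]
    rw [limitSection, dif_neg hx, inner_zero_right]
    exact tendsto_const_nhds

theorem ae_pathLength_ne_top (hξ : H.MeasurableSection ξ) (hξ1 : ∀ x, ‖ξ x‖ ≤ 1) :
    ∀ᵐ x ∂D.μ, G.pathLength π ξ x ≠ ∞ := by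
  have h : ∫⁻ x, G.pathLength π ξ x ∂D.μ ≠ ∞ :=
    ne_top_of_le_ne_top ENNReal.ofReal_ne_top (lintegral_pathLength_le hξ hξ1)
  filter_upwards [ae_lt_top (measurable_pathLength hξ hξ1) h] with x hx using hx.ne

/-- Moving a unit vector to 0 takes a path of length at least 1, and Markov's inequality bounds the
measure of the points with such a path. -/
theorem measure_limitSection_eq_zero_le (hξ : H.MeasurableSection ξ) (hξ1 : ∀ x, ‖ξ x‖ ≤ 1) :
    D.μ {x | ‖ξ x‖ = 1 ∧ G.limitSection π ξ x = 0} ≤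
      ENNReal.ofReal (√(G.energy π ξ) * (1 - G.rate)⁻¹) := by
  have hsub : {x | ‖ξ x‖ = 1 ∧ G.limitSection π ξ x = 0} ⊆ {x | 1 ≤ G.pathLength π ξ x} := by
    rintro x ⟨h1, h0⟩
    change 1 ≤ G.pathLength π ξ x
    by_cases hx : G.pathLength π ξ x = ∞
    · rw [hx]; exact le_top
    have h := dist_le_tsum_of_dist_le_of_tendsto₀ _
      (fun k => G.dist_averages_le (π := π) (ξ := ξ) k x) (summable_norm_drift hx)
      (tendsto_averages hx)
    rw [h0, dist_zero_right] at h
    change ‖ξ x‖ ≤ _ at h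
    rw [h1] at h
    rw [pathLength, ← ENNReal.ofReal_tsum_of_nonneg (fun _ => norm_nonneg _)
      (summable_norm_drift hx), ENNReal.one_le_ofReal]
    exact h
  refine (measure_mono hsub).trans (le_trans ?_ (lintegral_pathLength_le hξ hξ1))
  simpa using mul_meas_ge_le_lintegral (μ := D.μ) (measurable_pathLength (G := G) (π := π) hξ hξ1) 1

theorem measurable_sum_sq_norm_coboundary (hξ : H.MeasurableSection ξ) :
    Measurable fun x => ∑ y ∈ G.nb x, ENNReal.ofReal (‖π.coboundary ξ x y‖ ^ 2) :=
  measurable_sum_section_ennreal G.measurableSet_nb G.card_le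
    (ENNReal.measurable_ofReal.comp (π.measurableSection_coboundary hξ).sq_norm)

theorem lintegral_coboundary_le (hξ : H.MeasurableSection ξ) (hξ1 : ∀ x, ‖ξ x‖ ≤ 1) :
    ∫⁻ x, ∑ y ∈ G.nb x, ENNReal.ofReal (‖π.coboundary ξ x y‖ ^ 2) ∂D.μ ≤
      ENNReal.ofReal (G.energy π ξ) := by
  rw [energy, edgeIntegral, ofReal_integral_eq_lintegral_ofReal
    (EdgeBounded.weight.mul (edgeBounded_coboundary hξ hξ1)).integrable
    (Eventually.of_forall fun x => Finset.sum_nonneg fun y _ =>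
      mul_nonneg w_pos.le (sq_nonneg _))]
  refine lintegral_mono fun x => ?_
  rw [ENNReal.ofReal_sum_of_nonneg fun y _ => mul_nonneg w_pos.le (sq_nonneg _)]
  exact Finset.sum_le_sum fun y _ => ENNReal.ofReal_le_ofReal
    (le_mul_of_one_le_left (sq_nonneg _) one_le_w)

/-- The energies of the averages tend to 0, so by Fatou the lower limit of their local energies
vanishes almost everywhere; pointwise convergence identifies it with the local energy of the limit.
-/
theorem limitSection_invariant (hξ : H.MeasurableSection ξ) (hξ1 : ∀ x, ‖ξ x‖ ≤ 1) :
    ∀ᵐ x ∂D.μ, ∀ y ∈ G.nb x,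
      π.act x y (G.limitSection π ξ y) = G.limitSection π ξ x := by
  have hs := averages_spec (G := G) (π := π) hξ hξ1
  let f : ℕ → D.X → ℝ≥0∞ := fun k x =>
    ∑ y ∈ G.nb x, ENNReal.ofReal (‖π.coboundary (G.averages π ξ k) x y‖ ^ 2)
  have hf : ∀ k, Measurable (f k) := fun k => measurable_sum_sq_norm_coboundary (hs k).1
  have hE : Tendsto (fun k => ENNReal.ofReal ((1 - G.step * G.kappa) ^ k * G.energy π ξ)) atTop
      (𝓝 0) := by
    rw [← ENNReal.ofReal_zero]
    refine (ENNReal.continuous_ofReal.tendsto 0).comp ?_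
    have := (tendsto_pow_atTop_nhds_zero_of_lt_one (sq_nonneg G.rate)
      (pow_lt_one₀ G.rate_nonneg G.rate_lt_one two_ne_zero)).mul_const (G.energy π ξ)
    rwa [zero_mul, rate_sq] at this
  have hlim : Tendsto (fun k => ∫⁻ x, f k x ∂D.μ) atTop (𝓝 0) :=
    tendsto_of_tendsto_of_tendsto_of_le_of_le tendsto_const_nhds hE (fun _ => zero_le)
      fun k => (lintegral_coboundary_le (hs k).1 (hs k).2.1).trans
        (ENNReal.ofReal_le_ofReal (hs k).2.2)
  have h0 : ∫⁻ x, liminf (fun k => f k x) atTop ∂D.μ = 0 :=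
    le_antisymm ((lintegral_liminf_le hf).trans_eq hlim.liminf_eq) zero_le
  rw [lintegral_eq_zero_iff (Measurable.liminf hf)] at h0
  -- Saturating the exceptional null set gives convergence at the neighbours of x as well as at x.
  filter_upwards [h0, D.ae_forall_rel (ae_pathLength_ne_top (G := G) (π := π) hξ hξ1)]
    with x hx hgood y hy
  have hxg := hgood x (D.rel_refl x)
  have hconv : Tendsto (fun k => f k x) atTop
      (𝓝 (∑ y ∈ G.nb x, ENNReal.ofReal (‖π.coboundary (G.limitSection π ξ) x y‖ ^ 2))) := by
    refine tendsto_finsetSum _ fun z hz => (ENNReal.continuous_ofReal.tendsto _).comp ?_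
    refine Tendsto.pow (Tendsto.norm ?_) 2
    simp only [UnitaryRep.coboundary, π.act_of_rel (G.rel x z hz)]
    exact (((π.op x z (G.rel x z hz)).continuous.tendsto _).comp
      (tendsto_averages (hgood z (G.rel x z hz)))).sub (tendsto_averages hxg)
  have hsum : ∑ y ∈ G.nb x, ENNReal.ofReal (‖π.coboundary (G.limitSection π ξ) x y‖ ^ 2) = 0 :=
    hconv.liminf_eq.symm.trans hx
  have hyz := (Finset.sum_eq_zero_iff.1 hsum) y hy
  rw [ENNReal.ofReal_eq_zero] at hyz
  have : ‖π.coboundary (G.limitSection π ξ) x y‖ = 0 :=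
    pow_eq_zero_iff two_ne_zero |>.1 (le_antisymm hyz (sq_nonneg _))
  exact sub_eq_zero.1 (norm_eq_zero.1 this)

/-! ### From invariance along edges to an invariant unit field. -/

variable (G) in
/-- The edges generate the relation. -/
def Generating : Prop :=
  ∀ᵐ x ∂D.μ, ∀ y, D.Rel x y → Relation.ReflTransGen (fun a b => b ∈ G.nb a) x y

theorem invariant_of_edges (hG : G.Generating) {η : ∀ x, H.fiber x}
    (hη : ∀ᵐ x ∂D.μ, ∀ y ∈ G.nb x, π.act x y (η y) = η x) :
    ∀ᵐ x ∂D.μ, ∀ y, D.Rel x y → π.act x y (η y) = η x := by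
  filter_upwards [hG, D.ae_forall_rel hη] with x hx hinv y hxy
  have h := hx y hxy
  clear hxy
  suffices D.Rel x y ∧ π.act x y (η y) = η x from this.2
  induction h with
  | refl => exact ⟨D.rel_refl x, π.act_self _⟩
  | tail _ hbc ih =>
    rename_i b c _
    have hr := G.rel b c hbc
    refine ⟨ih.1.trans' hr, ?_⟩
    rw [← π.act_act ih.1 hr, hinv b ih.1 c hbc, ih.2]

/-- Dominated convergence: almost every vertex has finitely many edges, each eventually in `K n`,
and bounded degree dominates the local energies. -/
theorem tendsto_energy_zero {ξ : ℕ → ∀ x, H.fiber x} {K : ℕ → Set (D.X × D.X)} {ε : ℕ → ℝ}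
    (hξ : ∀ n, H.MeasurableSection (ξ n)) (hξ1 : ∀ n x, ‖ξ n x‖ ≤ 1) (hK : Monotone K)
    (hKe : D.AEPair fun x y _ => ∃ n, (x, y) ∈ K n) (hε : Tendsto ε atTop (𝓝 0))
    (hKξ : ∀ n, D.AEPair fun x y _ => (x, y) ∈ K n → ‖π.coboundary (ξ n) x y‖ ≤ ε n) :
    Tendsto (fun n => G.energy π (ξ n)) atTop (𝓝 0) := by
  have hzero : (0 : ℝ) = ∫ _ : D.X, (0 : ℝ) ∂D.μ := by simp
  rw [hzero]
  have hb : ∀ n, G.EdgeBounded fun x y => G.w x y * ‖π.coboundary (ξ n) x y‖ ^ 2 := fun n =>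
    EdgeBounded.weight.mul (edgeBounded_coboundary (hξ n) (hξ1 n))
  refine tendsto_integral_of_dominated_convergence (fun _ => G.N * ((G.N + 1) * 4))
    (fun n => (hb n).integrable.aestronglyMeasurable) (integrable_const _)
    (fun n => Eventually.of_forall fun x => ?_) ?_
  · rw [Real.norm_of_nonneg (Finset.sum_nonneg fun y _ => mul_nonneg w_pos.le (sq_nonneg _))]
    refine (Finset.sum_le_card_nsmul _ _ (((G.N : ℝ) + 1) * 4) fun y hy => ?_).trans ?_
    · refine mul_le_mul w_le ?_ (sq_nonneg _) (by positivity)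
      have := π.norm_coboundary_le (hξ1 n) (G.rel x y hy)
      nlinarith [norm_nonneg (π.coboundary (ξ n) x y)]
    · rw [nsmul_eq_mul]
      exact mul_le_mul_of_nonneg_right (by exact_mod_cast G.card_le x) (by positivity)
  · filter_upwards [hKe, ae_all_iff.2 hKξ] with x hx hxn
    rw [← Finset.sum_const_zero (s := G.nb x)]
    refine tendsto_finsetSum _ fun y hy => ?_
    have hr := G.rel x y hy
    obtain ⟨n0, hn0⟩ := hx y hr
    have h0 : Tendsto (fun n => ‖π.coboundary (ξ n) x y‖) atTop (𝓝 0) := by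
      refine squeeze_zero' (Eventually.of_forall fun _ => norm_nonneg _) ?_ hε
      filter_upwards [eventually_ge_atTop n0] with n hn
      exact hxn n y hr (hK hn hn0)
    simpa using (h0.pow 2).const_mul (G.w x y)

/-- Countably many invariant sections without common zeros can be glued into an invariant section of
unit vectors. -/
theorem _root_.DiscreteDesingularization.UnitaryRep.hasInvariantUnitField_of_seq
    {η : ℕ → ∀ x, H.fiber x} (hη : ∀ n, H.MeasurableSection (η n))
    (hinv : ∀ n, ∀ᵐ x ∂D.μ, ∀ y, D.Rel x y → π.act x y (η n y) = η n x)
    (hne : ∀ᵐ x ∂D.μ, ∃ n, η n x ≠ 0) : π.HasInvariantUnitField := by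
  classical
  -- The second alternative gives a default index at common zeros.
  have hex : ∀ x, ∃ n, η n x ≠ 0 ∨ ∀ m, η m x = 0 := by
    intro x
    by_cases h : ∀ m, η m x = 0
    · exact ⟨0, Or.inr h⟩
    · push Not at h
      obtain ⟨n, hn⟩ := h
      exact ⟨n, Or.inl hn⟩
  have hms : ∀ n, MeasurableSet {x | η n x = 0} := fun n => by
    have := (hη n).norm (measurableSet_singleton 0)
    convert this using 1
    ext x
    simp
  have hmset : ∀ n, MeasurableSet {x | η n x ≠ 0 ∨ ∀ m, η m x = 0} := fun n => by
    refine (hms n).compl.union ?_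
    have : {x | ∀ m, η m x = 0} = ⋂ m, {x | η m x = 0} := by ext; simp
    change MeasurableSet {x | ∀ m, η m x = 0}
    rw [this]
    exact MeasurableSet.iInter hms
  refine ⟨fun x => (‖η (Nat.find (hex x)) x‖⁻¹ : ℝ) • η (Nat.find (hex x)) x, fun m => ?_, ?_, ?_⟩
  · refine Measurable.find (f := fun n x =>
      inner ℂ (H.fundamental m x) ((‖η n x‖⁻¹ : ℝ) • η n x)) (fun n => ?_) hmset hex
    have := (hη n).smul (Complex.measurable_ofReal.comp (hη n).norm.inv) m
    convert this using 2 with x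
    simp only [Function.comp_apply, Pi.inv_apply, Complex.coe_smul]
  · filter_upwards [hne] with x hx
    have h : η (Nat.find (hex x)) x ≠ 0 := by
      rcases Nat.find_spec (hex x) with h | h
      · exact h
      · obtain ⟨n, hn⟩ := hx
        exact absurd (h n) hn
    rw [norm_smul, norm_inv, norm_norm, inv_mul_cancel₀ (norm_ne_zero_iff.2 h)]
  · filter_upwards [ae_all_iff.2 hinv] with x hx y hxy
    have hnorm : ∀ n, ‖η n x‖ = ‖η n y‖ := fun n => by rw [← hx n y hxy, π.norm_act hxy]
    -- Invariant fields vanish simultaneously at equivalent points, so the same index is chosen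
    -- along the class.
    have hzero : ∀ n, η n x = 0 ↔ η n y = 0 := fun n => by
      rw [← norm_eq_zero, hnorm, norm_eq_zero]
    have hfind : Nat.find (hex y) = Nat.find (hex x) :=
      Nat.find_congr' fun {n} => by simp only [ne_eq, hzero]
    rw [hfind, ← π.act_of_rel hxy, ← Complex.coe_smul, map_smul, Complex.coe_smul, hx _ y hxy,
      hnorm]

/-- Each almost invariant field is averaged to an invariant one. No single limit need be nonzero
almost everywhere, so the whole sequence of limits is glued. -/
theorem relPropertyT (hG : G.Generating) : D.RelPropertyT := by
  classical
  intro H π ⟨ξ, K, ε, hξ, hξ1, _, _, hK, hKe, hε, hKξ⟩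
  -- The averaging estimates require norm at most 1 everywhere; this changes each field on a null
  -- set only.
  let ζ : ℕ → ∀ x, H.fiber x := fun n x => if ‖ξ n x‖ = 1 then ξ n x else 0
  have hζ : ∀ n, H.MeasurableSection (ζ n) := fun n m => by
    have : Measurable fun x => if ‖ξ n x‖ = 1 then inner ℂ (H.fundamental m x) (ξ n x) else 0 :=
      Measurable.ite ((hξ n).norm (measurableSet_singleton 1)) (hξ n m) measurable_const
    convert this using 2 with x
    by_cases h : ‖ξ n x‖ = 1
    · simp only [ζ, if_pos h]
    · simp only [ζ, if_neg h, inner_zero_right]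
  have hζ1 : ∀ n x, ‖ζ n x‖ ≤ 1 := fun n x => by
    by_cases h : ‖ξ n x‖ = 1
    · simp only [ζ, if_pos h, h, le_refl]
    · simp only [ζ, if_neg h, norm_zero, zero_le_one]
  have hζξ : ∀ n, ∀ᵐ x ∂D.μ, ζ n x = ξ n x := fun n => by
    filter_upwards [hξ1 n] with x hx
    exact if_pos hx
  have hE : Tendsto (fun n => G.energy π (ζ n)) atTop (𝓝 0) := by
    refine tendsto_energy_zero hζ hζ1 hK hKe hε fun n => ?_
    filter_upwards [hKξ n, D.ae_forall_rel (hζξ n)] with x hx hxζ y hxy hxyK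
    rw [UnitaryRep.coboundary, π.act_of_rel hxy, hxζ x (D.rel_refl x), hxζ y hxy]
    exact hx y hxy hxyK
  refine UnitaryRep.hasInvariantUnitField_of_seq
    (fun n => measurableSection_limitSection (G := G) (π := π) (hζ n) (hζ1 n))
    (fun n => invariant_of_edges hG (limitSection_invariant (hζ n) (hζ1 n))) ?_
  -- Common zeros are zeros of every single limit, so their measure is below bounds that tend to 0.
  have hbound : ∀ n, D.μ {x | ¬ ∃ n, G.limitSection π (ζ n) x ≠ 0} ≤
      ENNReal.ofReal (√(G.energy π (ζ n)) * (1 - G.rate)⁻¹) := by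
    intro n
    refine le_trans (measure_mono_ae ?_)
      (measure_limitSection_eq_zero_le (G := G) (π := π) (hζ n) (hζ1 n))
    filter_upwards [hζξ n, hξ1 n] with x h1 h2 hx
    refine ⟨by rw [h1, h2], ?_⟩
    by_contra h
    exact hx ⟨n, h⟩
  have hlim : Tendsto (fun n => ENNReal.ofReal (√(G.energy π (ζ n)) * (1 - G.rate)⁻¹)) atTop
      (𝓝 0) := by
    rw [← ENNReal.ofReal_zero]
    refine (ENNReal.continuous_ofReal.tendsto 0).comp ?_
    have := ((Real.continuous_sqrt.tendsto 0).comp hE).mul_const (1 - G.rate)⁻¹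
    simpa using this
  exact le_antisymm (ge_of_tendsto' hlim hbound) zero_le

end GappedGraphing

end DiscreteDesingularization

/-! ### The graphing of a periodic complex -/

namespace PeriodicTwoComplex

open DiscreteDesingularization

variable {Q : Type u} {D : DiscreteDesingularization Q} (C : PeriodicTwoComplex D)

theorem mem_faces_of_subset {s t : Finset D.X} (ht : t ∈ C.complex.faces) (hs : s.Nonempty)
    (hst : s ⊆ t) : s ∈ C.complex.faces :=
  (C.complex.isRelLowerSet_faces ht).2 hst hs

theorem rel_of_adj {x y : D.X} (h : C.skeleton.Adj x y) : D.Rel x y := by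
  classical
  exact C.rel_of_mem _ h.2 x (by simp) y (by simp)

theorem encard_neighborSet_le {N : ℕ} {x : D.X}
    (h : {s ∈ C.complex.faces | x ∈ s}.encard ≤ N) : (C.skeleton.neighborSet x).encard ≤ N := by
  classical
  refine le_trans (Set.encard_le_encard_of_injOn (f := fun y => ({x, y} : Finset D.X)) ?_ ?_) h
  · intro y hy
    refine ⟨?_, by simp⟩
    convert hy.2
  · intro y hy z hz hyz
    have hyz' : ({x, y} : Finset D.X) = {x, z} := hyz
    have : y ∈ ({x, z} : Finset D.X) := hyz' ▸ by simp
    rcases Finset.mem_insert.1 this with h | h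
    · exact absurd h.symm hy.1
    · exact Finset.mem_singleton.1 h

open Classical in
/-- Three distinct vertices of a triangle. -/
def Triangle (x y z : D.X) : Prop := x ≠ y ∧ x ≠ z ∧ y ≠ z ∧ {x, y, z} ∈ C.complex.faces

variable {C} {x y z : D.X}

theorem Triangle.swap (h : C.Triangle x y z) : C.Triangle x z y := by
  classical
  refine ⟨h.2.1, h.1, h.2.2.1.symm, ?_⟩
  rw [Finset.pair_comm]
  exact h.2.2.2

theorem Triangle.rot (h : C.Triangle x y z) : C.Triangle y x z := by
  classical
  refine ⟨h.1.symm, h.2.2.1, h.2.1, ?_⟩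
  rw [Finset.insert_comm]
  exact h.2.2.2

theorem Triangle.adj (h : C.Triangle x y z) : C.skeleton.Adj x y := by
  classical
  refine ⟨h.1, C.mem_faces_of_subset h.2.2.2 (by simp) ?_⟩
  intro t
  simp only [Finset.mem_insert, Finset.mem_singleton]
  tauto

variable (C)

theorem measurableSet_triangle :
    MeasurableSet {p : D.X × D.X × D.X | C.Triangle p.1 p.2.1 p.2.2} := by
  have h1 : Measurable fun p : D.X × D.X × D.X => p.2.1 := measurable_fst.comp measurable_snd
  have h2 : Measurable fun p : D.X × D.X × D.X => p.2.2 := measurable_snd.comp measurable_snd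
  exact (measurableSet_eq_fun measurable_fst h1).compl.inter
    ((measurableSet_eq_fun measurable_fst h2).compl.inter
      ((measurableSet_eq_fun h1 h2).compl.inter C.measurableSet_triangles))

open Classical in
theorem link_gap {x : D.X} {nb : Finset D.X} (hnb : ∀ y, y ∈ nb ↔ y ∈ C.skeleton.neighborSet x)
    {lam : ℝ} (hc : (C.link x).Connected) (hlam : lam ≤ lambdaOne (C.link x))
    {E : Type*} [NormedAddCommGroup E] [InnerProductSpace ℂ E] (f : D.X → E) (a : E)
    (ha : ∑ y ∈ nb, max ((nb.filter (C.Triangle x y)).card : ℝ) 1 • (f y - a) = 0) :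
    lam * ∑ y ∈ nb, max ((nb.filter (C.Triangle x y)).card : ℝ) 1 * ‖f y - a‖ ^ 2 ≤
      2⁻¹ * ∑ y ∈ nb, ∑ z ∈ nb, if C.Triangle x y z then ‖f y - f z‖ ^ 2 else 0 := by
  have : Fintype (C.skeleton.neighborSet x) := Fintype.subtype nb hnb
  have hadj : ∀ y z : C.skeleton.neighborSet x, C.Triangle x y z ↔ (C.link x).Adj y z := by
    intro y z
    constructor
    · intro h
      exact ⟨fun hyz => h.2.2.1 (congrArg Subtype.val hyz), h.2.2.2⟩
    · intro h
      exact ⟨y.2.1, z.2.1, fun hyz => h.1 (Subtype.ext hyz), h.2⟩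
  have hsum : ∀ g : D.X → ℝ, ∑ y ∈ nb, g y = ∑ y : C.skeleton.neighborSet x, g y :=
    fun g => Finset.sum_subtype nb hnb g
  have hdeg : ∀ y : C.skeleton.neighborSet x,
      ((nb.filter (C.Triangle x y)).card : ℝ) = (C.link x).degree y := by
    intro y
    rw [← Finset.sum_boole, hsum,
      ← SimpleGraph.card_neighborFinset_eq_degree, SimpleGraph.neighborFinset_eq_filter,
      ← Finset.sum_boole]
    simp only [hadj]
  have ha' : ∑ y : C.skeleton.neighborSet x,
      max ((nb.filter (C.Triangle x y)).card : ℝ) 1 • (f y - a) = 0 := by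
    rw [← ha]
    exact (Finset.sum_subtype nb hnb
      fun y => max ((nb.filter (C.Triangle x y)).card : ℝ) 1 • (f y - a)).symm
  simp only [hsum, hadj, hdeg] at ha' ⊢
  exact weighted_gap (C.link x) hc hlam (f := fun y => f y) ha'

theorem tsum_rel_eq_sum {nb : Finset D.X} {p : D.X → Prop} (hnb : ∀ y ∈ nb, p y)
    {f : D.X → ℝ≥0∞} (hf : ∀ y ∉ nb, f y = 0) : ∑' y : {y // p y}, f y = ∑ y ∈ nb, f y := by
  classical
  have h1 : ∑' y : {y // p y}, f y = ∑' y, f y := by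
    refine tsum_subtype_eq_of_support_subset (s := {y | p y}) fun y hy => ?_
    by_contra h
    exact hy (hf y fun hy' => h (hnb y hy'))
  rw [h1]
  exact tsum_eq_sum hf

/-- The almost everywhere hypotheses hold on an invariant conull Borel set S. Deleting all edges and
triangles off S makes the conditions on the graphing hold at every point, and invariance keeps the
remaining adjacency symmetric and the leaves in S connected. -/
theorem exists_gappedGraphing (hconn : C.LeavesConnected) (hfin : C.UniformlyLocallyFinite)
    (δ : D.X → D.X → ℝ≥0) (hδ : D.IsRadonNikodymCocycle δ) (δμ : ℝ) (hδμ : 1 ≤ δμ)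
    (hbound : ∀ᵐ y ∂D.μ, ∀ z, C.skeleton.Adj y z → δμ⁻¹ ≤ (δ y z : ℝ) ∧ (δ y z : ℝ) ≤ δμ)
    (lam : ℝ) (hlam : δμ ^ 3 / 2 < lam)
    (hlink : ∀ᵐ x ∂D.μ, (C.link x).Connected ∧ lam ≤ lambdaOne (C.link x)) :
    ∃ G : D.GappedGraphing, G.Generating := by
  classical
  obtain ⟨N, hN⟩ := hfin
  obtain ⟨S, hS, hSae, hSP, hSinv⟩ := D.exists_invariant_conull
    (hN.and (hbound.and (hlink.and hconn)))
  have hex : ∀ x, ∃ s : Finset D.X, s.card ≤ N ∧ ∀ y, y ∈ s ↔ x ∈ S ∧ C.skeleton.Adj x y := by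
    intro x
    by_cases hx : x ∈ S
    · have hle := C.encard_neighborSet_le (hSP x hx).1
      have hf := Set.finite_of_encard_le_coe hle
      refine ⟨hf.toFinset, ?_, fun y => by simp [hx]⟩
      rw [hf.encard_eq_coe_toFinset_card] at hle
      exact_mod_cast hle
    · exact ⟨∅, by simp, fun y => by simp [hx]⟩
  choose nb hcard hnb using hex
  have hnbs : ∀ x, ∀ y ∈ nb x, x ∈ nb y := fun x y hy => by
    obtain ⟨hx, h⟩ := (hnb x y).1 hy
    exact (hnb y x).2 ⟨hSinv x y (C.rel_of_adj h) hx, h.symm⟩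
  have hrel : ∀ x, ∀ y ∈ nb x, D.Rel x y := fun x y hy => C.rel_of_adj ((hnb x y).1 hy).2
  have hmnb : MeasurableSet {p : D.X × D.X | p.2 ∈ nb p.1} := by
    have : {p : D.X × D.X | p.2 ∈ nb p.1} =
        Prod.fst ⁻¹' S ∩ ({p | p.1 = p.2}ᶜ ∩ {z | {z.1, z.2} ∈ C.complex.faces}) := by
      ext p
      exact hnb p.1 p.2
    rw [this]
    refine (measurable_fst hS).inter
      ((measurableSet_eq_fun measurable_fst measurable_snd).compl.inter ?_)
    convert C.measurableSet_edges
  let G : D.GappedGraphing :=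
    { nb := nb
      tri := fun x y z => x ∈ S ∧ C.Triangle x y z
      N := N
      δ := fun x y => δ x y
      bound := δμ
      lam := lam
      measurableSet_nb := hmnb
      measurableSet_tri := (measurable_fst hS).inter C.measurableSet_triangle
      measurable_δ := measurable_coe_nnreal_real.comp hδ.1
      card_le := hcard
      rel := hrel
      nb_symm := hnbs
      tri_mem := fun x y z h => (hnb x y).2 ⟨h.1, h.2.adj⟩
      tri_swap := fun x y z h => ⟨h.1, h.2.swap⟩
      tri_rot := fun x y z h => ⟨hSinv x y (C.rel_of_adj h.2.adj) h.1, h.2.rot⟩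
      one_le_bound := hδμ
      le_δ := fun x y hy => ((hSP x ((hnb x y).1 hy).1).2.1 y ((hnb x y).1 hy).2).1
      δ_le := fun x y hy => ((hSP x ((hnb x y).1 hy).1).2.1 y ((hnb x y).1 hy).2).2
      lt_lam := hlam
      gap := by
        intro x E _ _ f a ha
        by_cases hx : x ∈ S
        · simp only [hx, true_and] at ha ⊢
          obtain ⟨hc, hl⟩ := (hSP x hx).2.2.1
          convert C.link_gap (nb := nb x) (fun y => by rw [hnb]; simp [hx]) hc hl f a
            (by convert ha)
        · have h0 : nb x = ∅ := Finset.eq_empty_of_forall_notMem fun y hy => hx ((hnb x y).1 hy).1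
          simp [h0]
      transport := by
        intro F hF
        have hF' : Measurable (Function.uncurry fun x y => if y ∈ nb x then F x y else 0) :=
          Measurable.ite hmnb hF measurable_const
        have h := hδ.2 _ hF'
        have hl : ∀ x, ∑' y : {y // D.Rel x y}, (if y.1 ∈ nb x then F x y.1 else 0) =
            ∑ y ∈ nb x, F x y := fun x => by
          rw [tsum_rel_eq_sum (nb := nb x) (f := fun y => if y ∈ nb x then F x y else 0) (hrel x)
            fun y hy => if_neg hy]
          exact Finset.sum_congr rfl fun y hy => if_pos hy
        have hr : ∀ y, ∑' x : {x // D.Rel x y}, (if y ∈ nb x.1 then F x.1 y else 0) *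
            (δ x.1 y : ℝ≥0∞) = ∑ x ∈ nb y, F x y * ENNReal.ofReal (δ x y) := fun y => by
          rw [tsum_rel_eq_sum (nb := nb y)
            (f := fun x => (if y ∈ nb x then F x y else 0) * (δ x y : ℝ≥0∞))
            (fun x hx => hrel x y (hnbs y x hx))
            fun x hx => by rw [if_neg fun h => hx (hnbs x y h), zero_mul]]
          exact Finset.sum_congr rfl fun x hx => by
            rw [if_pos (hnbs y x hx), ENNReal.ofReal_coe_nnreal]
        simp only [hl, hr] at h
        exact h }
  refine ⟨G, ?_⟩
  filter_upwards [hSae] with x hx y hxy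
  have hreach := (SimpleGraph.reachable_iff_reflTransGen x y).1 ((hSP x hx).2.2.2 y hxy)
  suffices Relation.ReflTransGen (fun a b => b ∈ nb a) x y ∧ y ∈ S from this.1
  clear hxy
  induction hreach with
  | refl => exact ⟨.refl, hx⟩
  | tail _ hbc ih =>
    exact ⟨ih.1.tail ((hnb _ _).2 ⟨ih.2, hbc⟩), hSinv _ _ (C.rel_of_adj hbc) ih.2⟩

end PeriodicTwoComplex

theorem mainTheorem7 (S : SingularSpace.{u}) (D : DiscreteDesingularization S.carrier)
    (hD : S.IsDesingularization D) (C : PeriodicTwoComplex D)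
    (hconn : C.LeavesConnected) (hfin : C.UniformlyLocallyFinite)
    (δ : D.X → D.X → ℝ≥0) (hδ : D.IsRadonNikodymCocycle δ)
    (δμ : ℝ) (hδμ : 1 ≤ δμ)
    (hbound : ∀ᵐ y ∂D.μ, ∀ z, C.skeleton.Adj y z → δμ⁻¹ ≤ (δ y z : ℝ) ∧ (δ y z : ℝ) ≤ δμ)
    (lam : ℝ) (hlam : δμ ^ 3 / 2 < lam)
    (hlink : ∀ᵐ x ∂D.μ, (C.link x).Connected ∧ lam ≤ lambdaOne (C.link x)) :
    S.PropertyT := by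
  obtain ⟨G, hG⟩ := C.exists_gappedGraphing hconn hfin δ hδ δμ hδμ hbound lam hlam hlink
  intro D' hD'
  -- Property T goes from `D` to the reference desingularization and from there to `D'`.
  exact ((G.relPropertyT hG).of_equivalent hD).of_equivalent
    (DiscreteDesingularization.Equivalent.symm hD')
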